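/- Let $d\ge 1$ and let $\Omega\subset\mathbb{R}^d$ be a bounded open convex set (for instance a uniformly convex domain). Consider the Monge–Ampère problem $$\det D^2u=f\ \text{ in }\Omega,\qquad u=g\ \text{ on }\partial\Omega,\qquad u\ \text{convex},$$ where $f\ge 0$ is allowed to vanish. Let $\mathcal T_h$ be a finite conforming quasiuniform simplicial triangulation with mesh size $h=\max_{T}\operatorname{diam}T$ whose union of closed elements $\bar\Omega_h$ is contained in $\bar\Omega$ and whose boundary nodes (the vertices on $\partial\Omega_h$) lie on $\partial\Omega$. Let $\Omega_h^i$ and $\Omega_h^b$ be the sets of interior and boundary nodes, and let $X_h$ be the space of continuous functions on $\bar\Omega_h$ that are affine on every element. Let $\delta>0$, $\theta>0$, and let $\mathcal V_\theta$ be a set of $d$-tuples of unit vectors such that for every orthonormal basis $\{w_i\}_{i=1}^d$ of $\mathbb{R}^d$ there is $\{w_i^\theta\}_{i=1}^d\in\mathcal V_\theta$ with $\max_i|w_i-w_i^\theta|\le\theta$, and, conversely, for every $\{w_i^\theta\}_{i=1}^d\in\mathcal V_\theta$ there is an orthonormal basis $\{w_i\}_{i=1}^d$ with the same property. For $v\in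 X_h$, $x\in\Omega_h^i$ and a unit vector $w$ put $$\nabla^2_{\delta w}v(x)=\frac{v(x+\rho\delta w)-2v(x)+v(x-\rho\delta w)}{\rho^2\delta^2},$$ where $\rho\in(0,1]$ is the largest number with $x\pm\rho\delta w\in\bar\Omega_h$. A function $u_h^\varepsilon\in X_h$, $\varepsilon=(h,\delta,\theta)$, is a two scale solution if $$\min_{\{w_i\}\in\mathcal V_\theta}\Big[\prod_{i=1}^d\big(\nabla^2_{\delta w_i}u_h^\varepsilon(x)\big)^+-\sum_{i=1}^d\big(\nabla^2_{\delta w_i}u_h^\varepsilon(x)\big)^-\Big]=f(x)\quad\forall x\in\Omega_h^i,\qquad u_h^\varepsilon=g\ \text{ on }\Omega_h^b$$ (the minimum being read as an infimum if $\mathcal V_\theta$ is infinite). **Theorem (error estimate).** There is a constant $C>0$, depending only on $\Omega$, $d$ and the shape regularity constant of the mesh (an upper bound for the ratios between the diameters of the elements and of their inscribed balls), such that the following holds. If $\theta\le\frac1{4d}$, $\alpha\in(0,1]$, $u\in C^{2,\alpha}(\bar\Omega)$ solves the Monge–Ampère problem, and $u_h^\varepsilon$ is a two scale solution, then $$\|u-u_h^\varepsilon\|_{L^\infty(\Omega_h)}\le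 C\Big[\big(h^2(1+\delta^{-2})+\theta^2\big)|u|_{C^{1,1}(\bar\Omega)}+\delta^\alpha|u|_{C^{2,\alpha}(\bar\Omega)}\Big],$$ where $|u|_{C^{1,1}(\bar\Omega)}$ is the Lipschitz constant of $\nabla u$ and $|u|_{C^{2,\alpha}(\bar\Omega)}$ is the $\alpha$-Hölder constant of $D^2u$. -/

import Mathlib

open Set
open scoped NNReal

noncomputable section

/-- The Hessian matrix of `u` at `x` with respect to the canonical basis. -/
def hessianMatrix {d : ℕ} (u : EuclideanSpace ℝ (Fin d) → ℝ) (x : EuclideanSpace ℝ (Fin d)) :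
    Matrix (Fin d) (Fin d) ℝ :=
  Matrix.of fun i j =>
    fderiv ℝ (fderiv ℝ u) x (EuclideanSpace.single i 1) (EuclideanSpace.single j 1)

/-- The class `C^{2,α}` up to the boundary of an open set: `u` is continuous on the closure, twice
continuously differentiable inside, and its second derivative is `α`-Hölder continuous (hence it
extends continuously to the closure). -/
structure IsC2Holder {d : ℕ} (Ω : Set (EuclideanSpace ℝ (Fin d))) (α : ℝ≥0)
    (u : EuclideanSpace ℝ (Fin d) → ℝ) : Prop where
  continuousOn : ContinuousOn u (closure Ω)
  contDiffOn : ContDiffOn ℝ 2 u Ω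
  memHolder : MemHolder α (Ω.domRestrict (fderiv ℝ (fderiv ℝ u)))

/-- The `C^{1,1}` seminorm: the Lipschitz constant of the gradient. -/
def seminormC11 {d : ℕ} (Ω : Set (EuclideanSpace ℝ (Fin d)))
    (u : EuclideanSpace ℝ (Fin d) → ℝ) : ℝ :=
  nnHolderNorm 1 (Ω.domRestrict (fderiv ℝ u))

/-- The `C^{2,α}` seminorm: the `α`-Hölder constant of the second derivative. -/
def seminormC2Holder {d : ℕ} (Ω : Set (EuclideanSpace ℝ (Fin d))) (α : ℝ≥0)
    (u : EuclideanSpace ℝ (Fin d) → ℝ) : ℝ :=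
  nnHolderNorm α (Ω.domRestrict (fderiv ℝ (fderiv ℝ u)))

/-- `u` is a convex classical solution of the (possibly degenerate) Monge-Ampère problem
`det D²u = f ≥ 0` in `Ω`, `u = g` on `∂Ω`. -/
structure SolvesMongeAmpere {d : ℕ} (Ω : Set (EuclideanSpace ℝ (Fin d)))
    (f g u : EuclideanSpace ℝ (Fin d) → ℝ) : Prop where
  nonneg : ∀ x ∈ Ω, 0 ≤ f x
  convexOn : ConvexOn ℝ Ω u
  det_eq : ∀ x ∈ Ω, (hessianMatrix u x).det = f x
  boundary : ∀ x ∈ frontier Ω, u x = g x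

/-- The `d`-dimensional simplices (elements) of a simplicial complex, as sets of vertices. -/
def elements {d : ℕ} (K : Geometry.SimplicialComplex ℝ (EuclideanSpace ℝ (Fin d))) :
    Set (Finset (EuclideanSpace ℝ (Fin d))) :=
  {T | T ∈ K.faces ∧ T.card = d + 1}

/-- The interior nodes: vertices in the interior of the computational domain `K.space`, which is
the union of all the closed elements. -/
def interiorNodes {d : ℕ} (K : Geometry.SimplicialComplex ℝ (EuclideanSpace ℝ (Fin d))) :
    Set (EuclideanSpace ℝ (Fin d)) :=
  K.vertices ∩ interior K.space

/-- The boundary nodes: vertices on the boundary of the computational domain. -/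
def boundaryNodes {d : ℕ} (K : Geometry.SimplicialComplex ℝ (EuclideanSpace ℝ (Fin d))) :
    Set (EuclideanSpace ℝ (Fin d)) :=
  K.vertices ∩ frontier K.space

/-- `K` is a (conforming) simplicial triangulation of `Ω`: it has finitely many simplices, each
one is a face of a `d`-dimensional element, the computational domain `K.space` lies in the closure
of `Ω`, and all the boundary nodes lie on `∂Ω`. The computational domain need not fill `Ω`, since a
domain with curved boundary cannot be triangulated exactly. -/
structure IsTriangulation {d : ℕ} (Ω : Set (EuclideanSpace ℝ (Fin d)))
    (K : Geometry.SimplicialComplex ℝ (EuclideanSpace ℝ (Fin d))) : Prop where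
  finite : K.faces.Finite
  pure : ∀ s ∈ K.faces, ∃ T ∈ elements K, s ⊆ T
  space_subset : K.space ⊆ closure Ω
  boundaryNodes_subset : boundaryNodes K ⊆ frontier Ω

/-- The diameter of the simplex with vertex set `T`. -/
def elementDiam {d : ℕ} (T : Finset (EuclideanSpace ℝ (Fin d))) : ℝ :=
  Metric.diam (convexHull ℝ (T : Set (EuclideanSpace ℝ (Fin d))))

/-- `h` is the mesh size, the largest diameter of an element. -/
def IsMeshSize {d : ℕ} (K : Geometry.SimplicialComplex ℝ (EuclideanSpace ℝ (Fin d)))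
    (h : ℝ) : Prop :=
  IsGreatest (elementDiam '' elements K) h

/-- Shape regularity with constant `σ`: every element `T` contains a ball whose diameter `2r`
satisfies `diam T ≤ σ (2r)`. -/
def IsShapeRegular {d : ℕ} (K : Geometry.SimplicialComplex ℝ (EuclideanSpace ℝ (Fin d)))
    (σ : ℝ) : Prop :=
  ∀ T ∈ elements K, ∃ (c : EuclideanSpace ℝ (Fin d)) (r : ℝ), 0 < r ∧
    Metric.closedBall c r ⊆ convexHull ℝ (T : Set (EuclideanSpace ℝ (Fin d))) ∧
    elementDiam T ≤ σ * (2 * r)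

/-- The inverse assumption with constant `ν`: all the elements have diameter comparable to `h`.
Together with shape regularity this is quasiuniformity. -/
def IsQuasiUniform {d : ℕ} (K : Geometry.SimplicialComplex ℝ (EuclideanSpace ℝ (Fin d)))
    (h ν : ℝ) : Prop :=
  ∀ T ∈ elements K, h ≤ ν * elementDiam T

/-- The space `X_h` of continuous piecewise linear functions over the triangulation. Only the
values on the computational domain matter. -/
structure IsPiecewiseLinear {d : ℕ}
    (K : Geometry.SimplicialComplex ℝ (EuclideanSpace ℝ (Fin d)))
    (w : EuclideanSpace ℝ (Fin d) → ℝ) : Prop where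
  continuousOn : ContinuousOn w K.space
  affine : ∀ T ∈ elements K, ∃ A : EuclideanSpace ℝ (Fin d) →ᵃ[ℝ] ℝ,
    EqOn w A (convexHull ℝ (T : Set (EuclideanSpace ℝ (Fin d))))

/-- The largest `ρ ∈ (0,1]` such that both `x + ρδw` and `x - ρδw` are in the set `D`. (At an
interior point of a closed set `D` the supremum is attained.) -/
def stepFraction {d : ℕ} (D : Set (EuclideanSpace ℝ (Fin d))) (δ : ℝ)
    (x w : EuclideanSpace ℝ (Fin d)) : ℝ :=
  sSup {ρ : ℝ | 0 < ρ ∧ ρ ≤ 1 ∧ x + (ρ * δ) • w ∈ D ∧ x - (ρ * δ) • w ∈ D}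

/-- The centered second difference of `v` at `x` in the direction `w` at scale `δ`, with the step
reduced so as to stay in `D`. -/
def secondDifference {d : ℕ} (D : Set (EuclideanSpace ℝ (Fin d))) (δ : ℝ)
    (v : EuclideanSpace ℝ (Fin d) → ℝ) (x w : EuclideanSpace ℝ (Fin d)) : ℝ :=
  (v (x + (stepFraction D δ x w * δ) • w) - 2 * v x + v (x - (stepFraction D δ x w * δ) • w)) /
    ((stepFraction D δ x w) ^ 2 * δ ^ 2)

/-- `V` discretizes the set of all orthonormal bases with accuracy `θ`: its elements are
collections of `d` unit vectors, every orthonormal basis is within `θ` of an element of `V`, and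
every element of `V` is within `θ` of an orthonormal basis. -/
structure IsDirectionDiscretization {d : ℕ} (V : Set (Fin d → EuclideanSpace ℝ (Fin d)))
    (θ : ℝ) : Prop where
  unit : ∀ W ∈ V, ∀ i, ‖W i‖ = 1
  approx : ∀ w : Fin d → EuclideanSpace ℝ (Fin d), Orthonormal ℝ w →
    ∃ W ∈ V, ∀ i, ‖w i - W i‖ ≤ θ
  near : ∀ W ∈ V, ∃ w : Fin d → EuclideanSpace ℝ (Fin d), Orthonormal ℝ w ∧
    ∀ i, ‖w i - W i‖ ≤ θ

/-- The two scale discrete Monge-Ampère operator: the minimum over the collections `W ∈ V` of the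
product of the positive parts of the second differences minus the sum of their negative parts.
For an infinite `V` the minimum is understood as an infimum. -/
def twoScaleOperator {d : ℕ} (K : Geometry.SimplicialComplex ℝ (EuclideanSpace ℝ (Fin d)))
    (δ : ℝ) (V : Set (Fin d → EuclideanSpace ℝ (Fin d)))
    (v : EuclideanSpace ℝ (Fin d) → ℝ) (x : EuclideanSpace ℝ (Fin d)) : ℝ :=
  ⨅ W : V,
    ((∏ i, max (secondDifference K.space δ v x (W.1 i)) 0) -
      ∑ i, max (-secondDifference K.space δ v x (W.1 i)) 0)

/-- `v` is a solution of the two scale method with right hand side `f` and boundary data `g`. -/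
structure SolvesTwoScale {d : ℕ} (K : Geometry.SimplicialComplex ℝ (EuclideanSpace ℝ (Fin d)))
    (δ : ℝ) (V : Set (Fin d → EuclideanSpace ℝ (Fin d)))
    (f g v : EuclideanSpace ℝ (Fin d) → ℝ) : Prop where
  piecewiseLinear : IsPiecewiseLinear K v
  interior : ∀ x ∈ interiorNodes K, twoScaleOperator K δ V v x = f x
  boundary : ∀ x ∈ boundaryNodes K, v x = g x

end

/-! The proof is a discrete comparison argument with quadratic barriers. Write `L` and `H` for the
`C^{1,1}` and `C^{2,α}` seminorms and let `Ω` lie in the ball of radius `R` about 0. The function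
`u` is shifted by a multiple `M / 2` of `‖x‖² - R²`, which has the right sign on the closure of `Ω`
and whose second difference in any unit direction, divided by the squared step, is exactly 2. If the
shifted function and `uh` were in the wrong order at some node, the extremal node of their
difference would be interior; the second differences of `uh` there would be controlled by `D²u` plus
or minus `M`, and the discrete operator would differ strictly from `f`.

Consistency of the operator is linear algebra (`det_add_pow_le_prod`,
`exists_orthonormal_prod_sub_sum_lt_det`). For nearly orthonormal unit vectors, Hadamard's
inequality and a lower bound for the Gram determinant bound the product of second derivatives from
below by the determinant; near an eigenbasis the product is bounded from above. Both errors are of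
order `θ²`, because the first order terms cancel for unit vectors. The barrier perturbs each
directional second derivative additively, so no positive lower bound on `f` is needed; a slack `η >
0`, sent to 0 at the end, makes the inequalities strict.

In `lower_bound` the barrier is convex, hence lies below its interpolant, and no interpolation error
appears. In `upper_bound` interpolation costs `L h² / 2`, which gives `h² δ⁻²` after division by the
squared step. Shortened steps near the boundary do no harm: one of their ends lies on the frontier
of the mesh, where `uh` interpolates boundary values of `u`. -/

/-! ### Determinant inequalities from eigenvalues. -/

theorem Finset.prod_le_pow_card_of_sum_le {ι : Type*} [Fintype ι] {z : ι → ℝ} {t : ℝ}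
    (hz : ∀ i, 0 ≤ z i) (ht : 0 < t) (hs : ∑ i, z i ≤ Fintype.card ι * t) :
    ∏ i, z i ≤ t ^ Fintype.card ι := by
  have h1 : ∏ i, (z i / t) ≤ 1 := by
    -- The AM-GM inequality, via `x ≤ exp (x - 1)` for each normalized factor.
    calc ∏ i, (z i / t) ≤ ∏ i, Real.exp (z i / t - 1) := by
          refine Finset.prod_le_prod (fun i _ => div_nonneg (hz i) ht.le) fun i _ => ?_
          have := Real.add_one_le_exp (z i / t - 1)
          linarith
      _ = Real.exp (∑ i, (z i / t - 1)) := (Real.exp_sum _ _).symm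
      _ ≤ 1 := by
          rw [Real.exp_le_one_iff, Finset.sum_sub_distrib, ← Finset.sum_div]
          simp only [Finset.sum_const, Finset.card_univ, nsmul_eq_mul, mul_one]
          have := (div_le_iff₀ ht).2 hs
          linarith
  rw [Finset.prod_div_distrib, Finset.prod_const, Finset.card_univ,
    div_le_one (pow_pos ht _)] at h1
  exact h1

/-- Hadamard's inequality for positive semidefinite matrices. -/
theorem Matrix.PosSemidef.det_le_prod_of_diag_le {n : Type*} [Fintype n] [DecidableEq n]
    {G : Matrix n n ℝ} (hG : G.PosSemidef) {b : n → ℝ} (hb : ∀ i, 0 < b i)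
    (hGb : ∀ i, G i i ≤ b i) : G.det ≤ ∏ i, b i := by
  -- Rescaling makes the diagonal at most 1, so AM-GM for the eigenvalues bounds the determinant by
  -- 1.
  set D : Matrix n n ℝ := Matrix.diagonal fun i => (√(b i))⁻¹ with hD
  have hP : (D * G * D).PosSemidef := by
    have := hG.conjTranspose_mul_mul_same D
    rwa [show D.conjTranspose = D by simp [hD]] at this
  have htr : (D * G * D).trace ≤ Fintype.card n * 1 := by
    have h1 : ∀ i, (D * G * D) i i = G i i / b i := by
      intro i
      rw [hD, Matrix.mul_diagonal, Matrix.diagonal_mul]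
      have := Real.mul_self_sqrt (hb i).le
      have h0 := (Real.sqrt_pos.2 (hb i)).ne'
      rw [← this]
      field_simp
      rw [Real.sqrt_sq (Real.sqrt_nonneg _)]
    calc (D * G * D).trace = ∑ i, G i i / b i := by simp [Matrix.trace, h1]
      _ ≤ ∑ _i : n, (1 : ℝ) :=
        Finset.sum_le_sum fun i _ => (div_le_one (hb i)).2 (hGb i)
      _ = _ := by simp
  have hdet : (D * G * D).det ≤ 1 := by
    rw [hP.1.trace_eq_sum_eigenvalues] at htr
    rw [hP.1.det_eq_prod_eigenvalues]
    simpa using Finset.prod_le_pow_card_of_sum_le hP.eigenvalues_nonneg one_pos (by simpa using htr)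
  have hdd : D.det * D.det = (∏ i, b i)⁻¹ := by
    rw [hD, Matrix.det_diagonal, ← Finset.prod_mul_distrib, ← Finset.prod_inv_distrib]
    refine Finset.prod_congr rfl fun i _ => ?_
    rw [← mul_inv, Real.mul_self_sqrt (hb i).le]
  have hpos : 0 < ∏ i, b i := Finset.prod_pos fun i _ => hb i
  rw [Matrix.det_mul, Matrix.det_mul, mul_right_comm, hdd, inv_mul_le_iff₀ hpos] at hdet
  linarith

theorem Matrix.IsHermitian.trace_mul_self {n : Type*} [Fintype n] [DecidableEq n]
    {G : Matrix n n ℝ} (hG : G.IsHermitian) : (G * G).trace = ∑ i, hG.eigenvalues i ^ 2 := by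
  conv_lhs => rw [hG.spectral_theorem, ← map_mul, Matrix.diagonal_mul_diagonal]
  rw [Unitary.conjStarAlgAut_apply, Matrix.trace_mul_cycle]
  simp [Matrix.trace, sq]

/-- The trace forces the deviations `l i - 1` of the eigenvalues to sum to 0, and the Frobenius norm
bounds the sum of their squares by `N² e²`. The loss in the determinant is therefore quadratic in
`e`. -/
theorem Matrix.IsHermitian.one_le_det_mul_of_near_one {n : Type*} [Fintype n] [DecidableEq n]
    {G : Matrix n n ℝ} (hG : G.IsHermitian) {e : ℝ} (hdiag : ∀ i, G i i = 1)
    (hoff : ∀ i j, i ≠ j → |G i j| ≤ e) (he0 : 0 ≤ e) (he : (Fintype.card n : ℝ) * e ≤ 9 / 16) :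
    1 ≤ G.det * (1 + 5 / 2 * ((Fintype.card n : ℝ) * e ^ 2)) ^ Fintype.card n := by
  set N : ℝ := (Fintype.card n : ℝ) with hN
  have hN0 : 0 ≤ N := by positivity
  set l := hG.eigenvalues with hl
  have hsum : ∑ i, l i = N := by
    have := hG.trace_eq_sum_eigenvalues
    simp only [Matrix.trace, Matrix.diag, hdiag] at this
    simpa [hl, hN] using this.symm
  have hsq : ∑ i, (l i - 1) ^ 2 ≤ N ^ 2 * e ^ 2 := by
    have h1 : ∑ i, (l i - 1) ^ 2 = ∑ i, l i ^ 2 - N := by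
      have : ∀ i, (l i - 1) ^ 2 = l i ^ 2 - 2 * l i + 1 := fun i => by ring
      simp only [this, Finset.sum_add_distrib, Finset.sum_sub_distrib, ← Finset.mul_sum, hsum]
      simp; ring
    rw [h1, ← hG.trace_mul_self]
    have h2 : (G * G).trace - N = ∑ i, ((∑ j, G i j ^ 2) - 1) := by
      simp only [Matrix.trace, Matrix.diag, Matrix.mul_apply, Finset.sum_sub_distrib]
      congr 1
      · refine Finset.sum_congr rfl fun i _ => Finset.sum_congr rfl fun j _ => ?_
        rw [sq, show G j i = G i j by simpa using hG.apply i j]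
      · simp [hN]
    have h3 : ∀ i, (∑ j, G i j ^ 2) - 1 ≤ N * e ^ 2 := by
      intro i
      rw [← Finset.add_sum_erase _ _ (Finset.mem_univ i), hdiag]
      have : ∑ j ∈ Finset.univ.erase i, G i j ^ 2 ≤ ∑ j ∈ Finset.univ.erase i, e ^ 2 := by
        refine Finset.sum_le_sum fun j hj => ?_
        rw [← sq_abs]
        have := hoff i j (Finset.ne_of_mem_erase hj).symm
        gcongr
      have h4 : ∑ j ∈ Finset.univ.erase i, e ^ 2 ≤ ∑ j : n, e ^ 2 :=
        Finset.sum_le_sum_of_subset_of_nonneg (Finset.erase_subset _ _) fun _ _ _ => by positivity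
      simp only [Finset.sum_const, Finset.card_univ, nsmul_eq_mul] at h4
      simp only [Finset.sum_const, nsmul_eq_mul] at this
      linarith
    rw [h2]
    calc _ ≤ ∑ _i : n, N * e ^ 2 := Finset.sum_le_sum fun i _ => h3 i
      _ = _ := by simp [hN]; ring
  have hlow : ∀ i, -(9 / 16) ≤ l i - 1 := by
    intro i
    have h1 : (l i - 1) ^ 2 ≤ (9 / 16) ^ 2 := by
      calc (l i - 1) ^ 2 ≤ ∑ i, (l i - 1) ^ 2 :=
            Finset.single_le_sum (f := fun i => (l i - 1) ^ 2) (fun _ _ => sq_nonneg _)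
              (Finset.mem_univ i)
        _ ≤ (N * e) ^ 2 := by rw [mul_pow]; exact hsq
        _ ≤ _ := by gcongr
    exact (abs_le.1 (abs_le_of_sq_le_sq h1 (by norm_num))).1
  -- A quadratic majorant of `1 / l i`, valid for `l i - 1 ≥ -3/5`, hence under `hlow`. Its linear
  -- part sums to zero, and AM-GM bounds the product of the `z i`.
  set z : n → ℝ := fun i => 1 - (l i - 1) + 5 / 2 * (l i - 1) ^ 2
  have hz : ∀ i, 0 ≤ z i := fun i => by
    simp only [z]; nlinarith [sq_nonneg (l i - 1 - 1 / 5)]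
  have hlz : ∀ i, 1 ≤ l i * z i := fun i => by
    have h1 : l i * z i = 1 + (l i - 1) ^ 2 * (3 / 2 + 5 / 2 * (l i - 1)) := by
      simp only [z]; ring
    rw [h1]
    have : 0 ≤ 3 / 2 + 5 / 2 * (l i - 1) := by linarith [hlow i]
    nlinarith [mul_nonneg (sq_nonneg (l i - 1)) this]
  have hzs : ∑ i, z i ≤ N * (1 + 5 / 2 * (N * e ^ 2)) := by
    simp only [z, Finset.sum_add_distrib, Finset.sum_sub_distrib, ← Finset.mul_sum, hsum]
    simp only [Finset.sum_const, Finset.card_univ, nsmul_eq_mul, mul_one, ← hN]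
    linarith
  have hzp := Finset.prod_le_pow_card_of_sum_le hz (t := 1 + 5 / 2 * (N * e ^ 2)) (by positivity) hzs
  have hdet : G.det = ∏ i, l i := by simpa using hG.det_eq_prod_eigenvalues
  rw [hdet]
  calc (1 : ℝ) ≤ ∏ i, (l i * z i) := Finset.one_le_prod fun i _ => hlz i
    _ = (∏ i, l i) * ∏ i, z i := Finset.prod_mul_distrib
    _ ≤ _ := by
      refine mul_le_mul_of_nonneg_left hzp (Finset.prod_nonneg fun i _ => ?_)
      linarith [hlow i]

/-- The matrix of a bilinear form with respect to the canonical basis. -/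
noncomputable def bilinMatrix {d : ℕ}
    (B : EuclideanSpace ℝ (Fin d) →L[ℝ] EuclideanSpace ℝ (Fin d) →L[ℝ] ℝ) :
    Matrix (Fin d) (Fin d) ℝ :=
  Matrix.of fun i j => B (EuclideanSpace.single i 1) (EuclideanSpace.single j 1)

/-! ### Determinant of a bilinear form against products over nearly orthonormal directions. -/

section BilinearForm

variable {d : ℕ} (B : EuclideanSpace ℝ (Fin d) →L[ℝ] EuclideanSpace ℝ (Fin d) →L[ℝ] ℝ)

theorem bilin_apply_eq_dotProduct (x y : EuclideanSpace ℝ (Fin d)) :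
    B x y = x.ofLp ⬝ᵥ (bilinMatrix B).mulVec y.ofLp := by
  have hx : ∀ x : EuclideanSpace ℝ (Fin d), x = ∑ i, x i • EuclideanSpace.single i (1 : ℝ) := by
    intro x
    simpa using ((EuclideanSpace.basisFun (Fin d) ℝ).sum_repr x).symm
  conv_lhs => rw [hx x, hx y]
  simp only [map_sum, map_smul, sum_apply, smul_apply,
    smul_eq_mul, dotProduct, Matrix.mulVec, bilinMatrix, Matrix.of_apply, Finset.mul_sum]
  rw [Finset.sum_comm]
  refine Finset.sum_congr rfl fun i _ => Finset.sum_congr rfl fun j _ => ?_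
  ring

variable {B}

theorem bilinMatrix_isHermitian (hB : ∀ x y, B x y = B y x) : (bilinMatrix B).IsHermitian := by
  ext i j
  simp [bilinMatrix, hB]

theorem det_bilin_gram (W : Fin d → EuclideanSpace ℝ (Fin d)) :
    (Matrix.of fun i j => B (W i) (W j)).det =
      (bilinMatrix B).det * (Matrix.of fun i j => inner ℝ (W i) (W j)).det := by
  set M : Matrix (Fin d) (Fin d) ℝ := Matrix.of fun k i => W i k with hM
  have h1 : (Matrix.of fun i j => B (W i) (W j)) = M.transpose * (bilinMatrix B * M) := by
    ext i j
    rw [Matrix.of_apply, bilin_apply_eq_dotProduct]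
    simp [Matrix.mul_apply, dotProduct, Matrix.mulVec, hM]
  have h2 : (Matrix.of fun i j => inner ℝ (W i) (W j)) = M.transpose * M := by
    ext i j
    simp [Matrix.mul_apply, hM, PiLp.inner_apply, mul_comm]
  rw [h1, h2]
  simp only [Matrix.det_mul, Matrix.det_transpose]
  ring

theorem bilin_gram_posSemidef (hB : ∀ x y, B x y = B y x) (hpos : ∀ x, 0 ≤ B x x)
    (W : Fin d → EuclideanSpace ℝ (Fin d)) : (Matrix.of fun i j => B (W i) (W j)).PosSemidef := by
  refine Matrix.PosSemidef.of_dotProduct_mulVec_nonneg ?_ fun x => ?_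
  · ext i j
    simp [hB]
  · have := hpos (∑ i, x i • W i)
    simp only [map_sum, map_smul, sum_apply, smul_apply,
      smul_eq_mul] at this
    simp only [dotProduct, Matrix.mulVec, Matrix.of_apply, Finset.mul_sum]
    rw [Finset.sum_comm]
    refine this.trans_eq (Finset.sum_congr rfl fun i _ => ?_)
    rw [Finset.mul_sum]
    refine Finset.sum_congr rfl fun j _ => ?_
    rw [Pi.star_apply, star_trivial]
    ring

/-- For nearly orthonormal unit vectors the product of the perturbed second derivatives dominates
the determinant. -/
theorem det_add_pow_le_prod (hB : ∀ x y, B x y = B y x) (hpos : ∀ x, 0 ≤ B x x) {L : ℝ}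
    (hL : ∀ x, B x x ≤ L * ‖x‖ ^ 2) {θ η : ℝ} (hd : 0 < d) (hθ0 : 0 ≤ θ) (hθ : θ ≤ 1 / (4 * (d : ℝ)))
    (hη : 0 < η) {w W : Fin d → EuclideanSpace ℝ (Fin d)} (hw : Orthonormal ℝ w)
    (hW : ∀ i, ‖W i‖ = 1) (hwW : ∀ i, ‖w i - W i‖ ≤ θ) {s : Fin d → ℝ}
    (hs : ∀ i, B (W i) (W i) + 13 * d * θ ^ 2 * L + 2 * η ≤ s i) :
    (bilinMatrix B).det + η ^ d ≤ ∏ i, s i := by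
  have hd1 : (1 : ℝ) ≤ d := by exact_mod_cast hd
  have hdθ : d * θ ≤ 1 / 4 := by
    rw [le_div_iff₀ (by positivity)] at hθ
    linarith
  have hθ4 : θ ≤ 1 / 4 := by nlinarith
  set Γ : Matrix (Fin d) (Fin d) ℝ := Matrix.of fun i j => inner ℝ (W i) (W j) with hΓ
  have hΓdet : 1 ≤ Γ.det * (1 + 13 * d * θ ^ 2) ^ d := by
    have hH : Γ.IsHermitian := by
      ext i j
      simp [hΓ, real_inner_comm]
    have hoff : ∀ i j, i ≠ j → |Γ i j| ≤ 9 / 4 * θ := by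
      intro i j hij
      have h0 : inner ℝ (w i) (w j) = 0 := hw.2 hij
      have h1 : Γ i j = -inner ℝ (w i - W i) (w j) - inner ℝ (w i) (w j - W j)
          + inner ℝ (w i - W i) (w j - W j) := by
        simp only [hΓ, Matrix.of_apply, inner_sub_left, inner_sub_right, h0]; ring
      have a1 : |inner ℝ (w i - W i) (w j)| ≤ θ := by
        have := abs_real_inner_le_norm (w i - W i) (w j)
        rw [hw.1 j, mul_one] at this
        exact this.trans (hwW i)
      have a2 : |inner ℝ (w i) (w j - W j)| ≤ θ := by
        have := abs_real_inner_le_norm (w i) (w j - W j)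
        rw [hw.1 i, one_mul] at this
        exact this.trans (hwW j)
      have a3 : |inner ℝ (w i - W i) (w j - W j)| ≤ θ * θ :=
        (abs_real_inner_le_norm _ _).trans
          (mul_le_mul (hwW i) (hwW j) (norm_nonneg _) hθ0)
      rw [h1, abs_le]
      rw [abs_le] at a1 a2 a3
      constructor <;> nlinarith
    -- The off-diagonal bound is `2θ + θ² ≤ 9θ/4` as `θ ≤ 1/4`, and `dθ ≤ 1/4` gives `d · 9θ/4 ≤
    -- 9/16`. The constant 13 rounds up `5/2 · (9/4)²`.
    have := hH.one_le_det_mul_of_near_one (e := 9 / 4 * θ) (fun i => by simp [hΓ, hW]) hoff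
      (by positivity) (by simp only [Fintype.card_fin]; linarith)
    rw [Fintype.card_fin] at this
    have hdet0 : 0 ≤ Γ.det := by
      by_contra hneg
      have hp : 0 ≤ (1 + 5 / 2 * ((d : ℝ) * (9 / 4 * θ) ^ 2)) ^ d := by positivity
      nlinarith
    refine this.trans (mul_le_mul_of_nonneg_left ?_ hdet0)
    refine pow_le_pow_left₀ (by positivity) ?_ _
    nlinarith [mul_nonneg (Nat.cast_nonneg (α := ℝ) d) (sq_nonneg θ)]
  set c : ℝ := 1 + 13 * d * θ ^ 2 with hc
  have hc1 : 1 ≤ c := by rw [hc]; nlinarith [mul_nonneg (Nat.cast_nonneg (α := ℝ) d) (sq_nonneg θ)]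
  have hc0 : 0 < c := by linarith
  have ha0 : ∀ i, 0 ≤ B (W i) (W i) := fun i => hpos _
  have haL : ∀ i, B (W i) (W i) ≤ L := fun i => by simpa [hW] using hL (W i)
  -- The term `η / c` keeps the entries positive when `B` is degenerate and becomes `η` after
  -- multiplication by `c`. The other `η` in the hypothesis on `s` produces the gain `η ^ d`.
  set b : Fin d → ℝ := fun i => B (W i) (W i) + η / c with hb
  have hb0 : ∀ i, 0 < b i := fun i => add_pos_of_nonneg_of_pos (ha0 i) (by positivity)
  have hHad := (bilin_gram_posSemidef hB hpos W).det_le_prod_of_diag_le hb0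
    (fun i => by simp only [Matrix.of_apply, hb]; linarith [div_pos hη hc0])
  rw [det_bilin_gram] at hHad
  have hAdet : 0 ≤ (bilinMatrix B).det := by
    have := (bilin_gram_posSemidef hB hpos (fun i => EuclideanSpace.single i (1 : ℝ))).det_nonneg
    exact this
  have hcb : (bilinMatrix B).det ≤ ∏ i, (c * b i) := by
    rw [Finset.prod_mul_distrib, Finset.prod_const, Finset.card_univ, Fintype.card_fin]
    calc (bilinMatrix B).det ≤ (bilinMatrix B).det * (Γ.det * c ^ d) :=
          le_mul_of_one_le_right hAdet hΓdet
      _ = c ^ d * ((bilinMatrix B).det * Γ.det) := by ring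
      _ ≤ _ := by gcongr
  have hsb : ∀ i, c * b i + η ≤ s i := by
    intro i
    have h1 : c * b i = c * B (W i) (W i) + η := by
      simp only [hb]; field_simp
    have h2 : 13 * d * θ ^ 2 * B (W i) (W i) ≤ 13 * d * θ ^ 2 * L :=
      mul_le_mul_of_nonneg_left (haL i) (by positivity)
    have := hs i
    rw [h1, hc]
    linarith
  have hadd : ∏ i, (c * b i) + ∏ _i : Fin d, η ≤ ∏ i, (c * b i + η) := by
    have : Nonempty (Fin d) := ⟨⟨0, hd⟩⟩
    refine Finset.prod_add_prod_le (i := ⟨0, hd⟩) (Finset.mem_univ _) le_rfl ?_ ?_ ?_ ?_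
    · intro j _ _; linarith
    · intro j _ _; linarith [mul_pos hc0 (hb0 j)]
    · intro j _; exact (mul_pos hc0 (hb0 j)).le
    · intro j _; exact hη.le
  rw [Finset.prod_const, Finset.card_univ, Fintype.card_fin] at hadd
  have hfin : ∏ i, (c * b i + η) ≤ ∏ i, s i :=
    Finset.prod_le_prod (fun i _ => by linarith [mul_pos hc0 (hb0 i)]) fun i _ => hsb i
  linarith

/-- There is an orthonormal basis such that, for nearby unit vectors, the product of the second
derivatives is controlled by the determinant. -/
theorem exists_orthonormal_prod_sub_sum_lt_det (hB : ∀ x y, B x y = B y x) {L : ℝ}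
    (hL : ∀ x, |B x x| ≤ L * ‖x‖ ^ 2) (hd : 0 < d) (hdet : 0 ≤ (bilinMatrix B).det) :
    ∃ w : Fin d → EuclideanSpace ℝ (Fin d), Orthonormal ℝ w ∧
      ∀ (θ η : ℝ) (W : Fin d → EuclideanSpace ℝ (Fin d)) (s : Fin d → ℝ), 0 < η →
        (∀ i, ‖W i‖ = 1) → (∀ i, ‖w i - W i‖ ≤ θ) →
        (∀ i, s i + η ≤ B (W i) (W i) - 2 * θ ^ 2 * L) →
        ∏ i, max (s i) 0 - ∑ i, max (-s i) 0 < (bilinMatrix B).det := by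
  have hA := bilinMatrix_isHermitian hB
  set w := hA.eigenvectorBasis with hw
  set l := hA.eigenvalues with hl
  have hBw : ∀ i y, B y (w i) = l i * inner ℝ y (w i) := by
    intro i y
    rw [bilin_apply_eq_dotProduct, hA.mulVec_eigenvectorBasis, dotProduct_smul]
    simp [dotProduct, PiLp.inner_apply, mul_comm, hl, hw]
  have hlL : ∀ i, |l i| ≤ L := by
    intro i
    have := hL (w i)
    rw [hBw, real_inner_self_eq_norm_sq, w.orthonormal.1 i] at this
    simpa using this
  refine ⟨w, w.orthonormal, fun θ η W s hη hW hwW hs => ?_⟩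
  -- Since `W i` and `w i` are unit vectors, `2⟨e, w i⟩ = -‖e‖²`; as `w i` is an eigenvector, the
  -- first order term in `e` becomes second order.
  have hsl : ∀ i, s i + η ≤ l i := by
    intro i
    set e := W i - w i with he
    have hee : ‖e‖ ≤ θ := by rw [he, norm_sub_rev]; exact hwW i
    have hWe : W i = w i + e := by simp [he]
    have h1 : ‖W i‖ ^ 2 = 1 + 2 * inner ℝ e (w i) + ‖e‖ ^ 2 := by
      rw [hWe, norm_add_sq_real, w.orthonormal.1 i, real_inner_comm]; ring
    rw [hW i] at h1
    have h2 : B (W i) (W i) = l i - l i * ‖e‖ ^ 2 + B e e := by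
      have : B (W i) (W i) = B (w i) (w i) + 2 * B e (w i) + B e e := by
        rw [hWe]
        simp only [map_add, add_apply]
        rw [hB (w i) e]; ring
      rw [this, hBw, hBw, real_inner_self_eq_norm_sq, w.orthonormal.1 i]
      linear_combination (-(l i)) * h1
    have h3 := abs_le.1 (hL e)
    have h4 := abs_le.1 (hlL i)
    have h5 : ‖e‖ ^ 2 ≤ θ ^ 2 := by gcongr
    have h6 : 0 ≤ L := (abs_nonneg _).trans (hlL i)
    have := hs i
    nlinarith [mul_le_mul_of_nonneg_left h5 h6, sq_nonneg ‖e‖,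
      mul_nonneg (sub_nonneg.2 h4.1) (sq_nonneg ‖e‖)]
  have hdl : (bilinMatrix B).det = ∏ i, l i := by simpa using hA.det_eq_prod_eigenvalues
  have hsum : 0 ≤ ∑ i, max (-s i) 0 := Finset.sum_nonneg fun i _ => le_max_right _ _
  -- A negative `s i` kills the product and leaves a negative value, below the nonnegative
  -- determinant. Otherwise all eigenvalues are positive and the products compare factor by factor.
  by_cases hneg : ∃ i, s i < 0
  · obtain ⟨i, hi⟩ := hneg
    have h1 : ∏ i, max (s i) 0 = 0 :=
      Finset.prod_eq_zero (Finset.mem_univ i) (max_eq_right hi.le)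
    have h2 : 0 < ∑ i, max (-s i) 0 :=
      Finset.sum_pos' (fun i _ => le_max_right _ _)
        ⟨i, Finset.mem_univ i, lt_max_of_lt_left (by linarith)⟩
    rw [h1]; linarith
  · push Not at hneg
    have hl0 : ∀ i, 0 < l i := fun i => by linarith [hneg i, hsl i]
    have h1 : ∏ i, max (s i) 0 < ∏ i, l i := by
      by_cases hz : ∃ i, s i = 0
      · obtain ⟨i, hi⟩ := hz
        rw [Finset.prod_eq_zero (Finset.mem_univ i) (by simp [hi])]
        exact Finset.prod_pos fun i _ => hl0 i
      · push Not at hz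
        have hs0 : ∀ i, 0 < s i := fun i => lt_of_le_of_ne (hneg i) (hz i).symm
        refine Finset.prod_lt_prod (fun i _ => lt_max_of_lt_left (hs0 i))
          (fun i _ => ?_) ⟨⟨0, hd⟩, Finset.mem_univ _, ?_⟩
        · rw [max_eq_left (hneg i)]; linarith [hsl i]
        · rw [max_eq_left (hneg _)]; linarith [hsl ⟨0, hd⟩]
    linarith

end BilinearForm

/-! ### Convexity and second differences along segments. -/

theorem ConvexOn.closure_of_continuousOn {E : Type*} [NormedAddCommGroup E] [NormedSpace ℝ E]
    {s : Set E} {f : E → ℝ} (hf : ConvexOn ℝ s f) (hc : ContinuousOn f (closure s)) :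
    ConvexOn ℝ (closure s) f := by
  refine ⟨hf.1.closure, fun x hx y hy a b ha hb hab => ?_⟩
  obtain ⟨p, hp, hpx⟩ := mem_closure_iff_seq_limit.1 hx
  obtain ⟨q, hq, hqy⟩ := mem_closure_iff_seq_limit.1 hy
  have key : ∀ {r : ℕ → E} {z : E}, (∀ n, r n ∈ s) → z ∈ closure s →
      Filter.Tendsto r Filter.atTop (nhds z) →
      Filter.Tendsto (fun n => f (r n)) Filter.atTop (nhds (f z)) := fun hr hz hrz =>
    (hc _ hz).tendsto.comp (tendsto_nhdsWithin_iff.2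
      ⟨hrz, Filter.Eventually.of_forall fun n => subset_closure (hr n)⟩)
  have h1 := key (fun n => hf.1 (hp n) (hq n) ha hb hab) (hf.1.closure hx hy ha hb hab)
    ((hpx.const_smul a).add (hqy.const_smul b))
  have h2 := ((key hp hx hpx).const_smul a).add ((key hq hy hqy).const_smul b)
  exact le_of_tendsto_of_tendsto' h1 h2 fun n => hf.2 (hp n) (hq n) ha hb hab

/-- Midpoint convexity of `g s - k / 2 * s ^ 2`. Only continuity is needed at the endpoints, which
may correspond to points of `∂Ω`. -/
theorem mul_sq_le_second_difference {g g' g'' : ℝ → ℝ} {t k : ℝ} (ht : 0 < t)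
    (hg : ContinuousOn g (Icc (-t) t)) (hg' : ∀ s ∈ Ioo (-t) t, HasDerivAt g (g' s) s)
    (hg'' : ∀ s ∈ Ioo (-t) t, HasDerivAt g' (g'' s) s) (hk : ∀ s ∈ Ioo (-t) t, k ≤ g'' s) :
    k * t ^ 2 ≤ g t - 2 * g 0 + g (-t) := by
  have hconv : ConvexOn ℝ (Icc (-t) t) fun s => g s - k / 2 * s ^ 2 := by
    refine convexOn_of_hasDerivWithinAt2_nonneg (convex_Icc _ _) (f' := fun s => g' s - k * s)
      (f'' := fun s => g'' s - k) (hg.sub (by fun_prop)) ?_ ?_ ?_ <;> rw [interior_Icc]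
    · intro s hs
      have h1 : HasDerivAt (fun s : ℝ => k / 2 * s ^ 2) (k * s) s :=
        (((hasDerivAt_pow 2 s).const_mul (k / 2))).congr_deriv (by push_cast; ring)
      exact ((hg' s hs).sub h1).hasDerivWithinAt
    · intro s hs
      have h1 : HasDerivAt (fun s : ℝ => k * s) k s := by
        simpa using (hasDerivAt_id s).const_mul k
      exact ((hg'' s hs).sub h1).hasDerivWithinAt
    · intro s hs
      linarith [hk s hs]
  have := hconv.2 (show t ∈ Icc (-t) t from ⟨by linarith, le_rfl⟩)
    (show -t ∈ Icc (-t) t from ⟨le_rfl, by linarith⟩)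
    (show (0 : ℝ) ≤ 1 / 2 by norm_num) (show (0 : ℝ) ≤ 1 / 2 by norm_num) (by norm_num)
  simp only [smul_eq_mul] at this
  rw [show 1 / 2 * t + 1 / 2 * -t = 0 by ring] at this
  nlinarith

section SecondDerivative

variable {E : Type*} [NormedAddCommGroup E] [InnerProductSpace ℝ E] {Ω : Set E} {u : E → ℝ}

theorem hasDerivAt_comp_add_smul (hΩ : IsOpen Ω) (hu : ContDiffOn ℝ 2 u Ω) {z v : E} {s : ℝ}
    (hs : z + s • v ∈ Ω) :
    HasDerivAt (fun s : ℝ => u (z + s • v)) (fderiv ℝ u (z + s • v) v) s := by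
  have h1 : HasDerivAt (fun s : ℝ => z + s • v) v s := by
    simpa using ((hasDerivAt_id s).smul_const v).const_add z
  have h2 : DifferentiableAt ℝ u (z + s • v) :=
    (hu.contDiffAt (hΩ.mem_nhds hs)).differentiableAt (by norm_num)
  exact h2.hasFDerivAt.comp_hasDerivAt s h1

theorem differentiableAt_fderiv_of_contDiffOn (hΩ : IsOpen Ω) (hu : ContDiffOn ℝ 2 u Ω) {z : E}
    (hz : z ∈ Ω) : DifferentiableAt ℝ (fderiv ℝ u) z :=
  ((hu.contDiffAt (hΩ.mem_nhds hz)).fderiv_right (m := 1) (by norm_num)).differentiableAt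
    (by norm_num)

theorem hasDerivAt_fderiv_comp_add_smul (hΩ : IsOpen Ω) (hu : ContDiffOn ℝ 2 u Ω) {z v : E}
    {s : ℝ} (hs : z + s • v ∈ Ω) :
    HasDerivAt (fun s : ℝ => fderiv ℝ u (z + s • v) v)
      (fderiv ℝ (fderiv ℝ u) (z + s • v) v v) s := by
  have h1 : HasDerivAt (fun s : ℝ => z + s • v) v s := by
    simpa using ((hasDerivAt_id s).smul_const v).const_add z
  have h2 := (differentiableAt_fderiv_of_contDiffOn hΩ hu hs).hasFDerivAt.comp_hasDerivAt s h1
  simpa using h2.clm_apply (hasDerivAt_const s v)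

theorem fderiv_fderiv_symm_of_contDiffOn (hΩ : IsOpen Ω) (hu : ContDiffOn ℝ 2 u Ω) {z : E}
    (hz : z ∈ Ω) (v w : E) :
    fderiv ℝ (fderiv ℝ u) z v w = fderiv ℝ (fderiv ℝ u) z w v :=
  ((hu.contDiffAt (hΩ.mem_nhds hz)).isSymmSndFDerivAt (by simp)) v w

/-- A segment from an interior point of a convex set to a point of the closure stays in the
interior, except possibly at its far end. -/
theorem Convex.add_smul_mem_of_mem_closure (hΩ : IsOpen Ω) (hconv : Convex ℝ Ω) {z v : E} {t : ℝ}
    (ht : 0 < t) (hz : z ∈ Ω) (h1 : z + t • v ∈ closure Ω) (h2 : z - t • v ∈ closure Ω) {s : ℝ}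
    (hs : s ∈ Ioo (-t) t) : z + s • v ∈ Ω := by
  have key : ∀ (w : E) (r : ℝ), 0 ≤ r → r < t → z + t • w ∈ closure Ω → z + r • w ∈ Ω := by
    intro w r hr hrt hw
    have := hconv.combo_interior_closure_mem_interior (x := z) (y := z + t • w)
      (by rwa [hΩ.interior_eq]) hw (a := 1 - r / t) (b := r / t)
      (by rw [sub_pos, div_lt_one ht]; exact hrt) (by positivity) (by ring)
    rw [hΩ.interior_eq] at this
    convert this using 1
    rw [smul_add, smul_smul, div_mul_cancel₀ _ ht.ne', sub_smul, one_smul]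
    abel
  rcases le_total 0 s with h | h
  · exact key v s h hs.2 h1
  · have := key (-v) (-s) (by linarith) (by linarith [hs.1]) (by simpa [sub_eq_add_neg] using h2)
    simpa using this

theorem second_difference_bounds (hΩ : IsOpen Ω) (hconv : Convex ℝ Ω) (hu : ContDiffOn ℝ 2 u Ω)
    (huc : ContinuousOn u (closure Ω)) {z v : E} {t a b : ℝ}
    (ht : 0 < t) (hz : z ∈ Ω) (h1 : z + t • v ∈ closure Ω) (h2 : z - t • v ∈ closure Ω)
    (hab : ∀ s ∈ Ioo (-t) t, fderiv ℝ (fderiv ℝ u) (z + s • v) v v ∈ Icc a b) :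
    u (z + t • v) - 2 * u z + u (z - t • v) ∈ Icc (a * t ^ 2) (b * t ^ 2) := by
  have hmem := fun s hs => hconv.add_smul_mem_of_mem_closure hΩ ht hz h1 h2 (s := s) hs
  have hcont : ContinuousOn (fun s : ℝ => u (z + s • v)) (Icc (-t) t) := by
    refine huc.comp (by fun_prop) fun s hs => ?_
    rcases eq_or_lt_of_le hs.1 with h | h
    · rw [← h]; simpa [sub_eq_add_neg] using h2
    rcases eq_or_lt_of_le hs.2 with h' | h'
    · rw [h']; exact h1
    · exact subset_closure (hmem s ⟨h, h'⟩)
  have hd1 := fun s hs => hasDerivAt_comp_add_smul hΩ hu (hmem s hs)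
  have hd2 := fun s hs => hasDerivAt_fderiv_comp_add_smul hΩ hu (hmem s hs)
  have lo := mul_sq_le_second_difference ht hcont hd1 hd2 fun s hs => (hab s hs).1
  have hi := mul_sq_le_second_difference ht hcont.neg (fun s hs => (hd1 s hs).neg)
    (fun s hs => (hd2 s hs).neg) (k := -b) fun s hs => neg_le_neg (hab s hs).2
  simp only [zero_smul, add_zero, neg_smul, ← sub_eq_add_neg] at lo hi
  simp only [Pi.neg_apply, zero_smul, add_zero, neg_smul, ← sub_eq_add_neg] at hi
  exact ⟨lo, by linarith⟩

/-- A negative second derivative would persist, by continuity, on a short segment and make a second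
difference negative, against midpoint convexity. -/
theorem ConvexOn.fderiv_fderiv_nonneg (hΩ : IsOpen Ω) (hu : ContDiffOn ℝ 2 u Ω)
    (hconv : ConvexOn ℝ Ω u) {z : E} (hz : z ∈ Ω) (v : E) : 0 ≤ fderiv ℝ (fderiv ℝ u) z v v := by
  by_contra! hneg
  set c := fderiv ℝ (fderiv ℝ u) z v v with hc
  have hcont : ContinuousAt (fun s : ℝ => fderiv ℝ (fderiv ℝ u) (z + s • v) v v) 0 := by
    have h1 : ContinuousAt (fderiv ℝ (fderiv ℝ u)) (z + (0 : ℝ) • v) := by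
      rw [zero_smul, add_zero]
      exact (((hu.contDiffAt (hΩ.mem_nhds hz)).fderiv_right (m := 1) (by norm_num)).fderiv_right
        (m := 0) (by norm_num)).continuousAt
    have h2 : ContinuousAt (fun s : ℝ => fderiv ℝ (fderiv ℝ u) (z + s • v)) 0 :=
      ContinuousAt.comp (f := fun s : ℝ => z + s • v) h1 (by fun_prop)
    exact (h2.clm_apply continuousAt_const).clm_apply continuousAt_const
  have hev : ∀ᶠ s : ℝ in nhds 0, fderiv ℝ (fderiv ℝ u) (z + s • v) v v ≤ c / 2 ∧ z + s • v ∈ Ω := by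
    refine Filter.Eventually.and ?_ ?_
    · refine (hcont.eventually_lt_const (u := c / 2) ?_).mono fun s hs => hs.le
      simp only [zero_smul, add_zero]; linarith
    · refine ContinuousAt.eventually_mem (f := fun s : ℝ => z + s • v) (by fun_prop) ?_
      simpa using hΩ.mem_nhds hz
  obtain ⟨ε, hε, hball⟩ := Metric.eventually_nhds_iff.1 hev
  have hmem : ∀ s : ℝ, |s| < ε →
      fderiv ℝ (fderiv ℝ u) (z + s • v) v v ≤ c / 2 ∧ z + s • v ∈ Ω := fun s hs =>
    hball (by simpa [Real.dist_eq] using hs)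
  have ht : 0 < ε / 2 := by positivity
  have hin : ∀ s ∈ Icc (-(ε / 2)) (ε / 2), |s| < ε := fun s hs => by
    rw [abs_lt]; constructor <;> linarith [hs.1, hs.2]
  have hd1 : ∀ s ∈ Icc (-(ε / 2)) (ε / 2), _ := fun s hs =>
    hasDerivAt_comp_add_smul hΩ hu (hmem s (hin s hs)).2
  have hd2 : ∀ s ∈ Icc (-(ε / 2)) (ε / 2), _ := fun s hs =>
    hasDerivAt_fderiv_comp_add_smul hΩ hu (hmem s (hin s hs)).2
  have key := mul_sq_le_second_difference ht
    (fun s hs => (hd1 s hs).neg.continuousAt.continuousWithinAt)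
    (fun s hs => (hd1 s (Ioo_subset_Icc_self hs)).neg)
    (fun s hs => (hd2 s (Ioo_subset_Icc_self hs)).neg) (k := -(c / 2))
    fun s hs => neg_le_neg (hmem s (hin s (Ioo_subset_Icc_self hs))).1
  simp only [Pi.neg_apply, zero_smul, add_zero] at key
  have hmid := hconv.2 (hmem (ε / 2) (hin _ ⟨by linarith, le_rfl⟩)).2
    (hmem (-(ε / 2)) (hin _ ⟨le_rfl, by linarith⟩)).2
    (show (0 : ℝ) ≤ 1 / 2 by norm_num) (show (0 : ℝ) ≤ 1 / 2 by norm_num) (by norm_num)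
  rw [show (1 / 2 : ℝ) • (z + (ε / 2) • v) + (1 / 2 : ℝ) • (z + (-(ε / 2)) • v) = z by
    module] at hmid
  simp only [smul_eq_mul] at hmid
  nlinarith [mul_pos (neg_pos.2 hneg) (pow_pos ht 2)]

/-- This semiconcavity is the source of the interpolation error bound. It is proved on segments
inside `Ω` and passes to the closure by continuity. -/
theorem concaveOn_sub_norm_sq (hΩ : IsOpen Ω) (hconv : Convex ℝ Ω) (hu : ContDiffOn ℝ 2 u Ω)
    (huc : ContinuousOn u (closure Ω)) {L : ℝ}
    (hL : ∀ x ∈ Ω, ∀ v, fderiv ℝ (fderiv ℝ u) x v v ≤ L * ‖v‖ ^ 2) :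
    ConcaveOn ℝ (closure Ω) fun x => u x - L / 2 * ‖x‖ ^ 2 := by
  have main : ConvexOn ℝ Ω fun x => L / 2 * ‖x‖ ^ 2 - u x := by
    refine ⟨hconv, fun x hx y hy a b ha hb hab => ?_⟩
    set v := y - x with hv
    have hmem : ∀ s ∈ Icc (0 : ℝ) 1, x + s • v ∈ Ω := fun s hs => by
      have := hconv hx hy (sub_nonneg.2 hs.2) hs.1 (by ring)
      convert this using 1
      rw [hv]; module
    have h1 : ConvexOn ℝ (Icc 0 1) fun s : ℝ => L * ‖v‖ ^ 2 / 2 * s ^ 2 - u (x + s • v) := by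
      refine convexOn_of_hasDerivWithinAt2_nonneg (convex_Icc _ _)
        (f' := fun s => L * ‖v‖ ^ 2 * s - fderiv ℝ u (x + s • v) v)
        (f'' := fun s => L * ‖v‖ ^ 2 - fderiv ℝ (fderiv ℝ u) (x + s • v) v v) ?_ ?_ ?_ ?_
      · exact fun s hs => ((Continuous.continuousAt (by fun_prop)).sub
          (hasDerivAt_comp_add_smul hΩ hu (hmem s hs)).continuousAt).continuousWithinAt
      · intro s hs
        have h1 : HasDerivAt (fun s : ℝ => L * ‖v‖ ^ 2 / 2 * s ^ 2) (L * ‖v‖ ^ 2 * s) s :=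
          (((hasDerivAt_pow 2 s).const_mul _)).congr_deriv (by push_cast; ring)
        exact (h1.sub (hasDerivAt_comp_add_smul hΩ hu
          (hmem s (interior_subset hs)))).hasDerivWithinAt
      · intro s hs
        have h1 : HasDerivAt (fun s : ℝ => L * ‖v‖ ^ 2 * s) (L * ‖v‖ ^ 2) s := by
          simpa using (hasDerivAt_id s).const_mul (L * ‖v‖ ^ 2)
        exact (h1.sub (hasDerivAt_fderiv_comp_add_smul hΩ hu
          (hmem s (interior_subset hs)))).hasDerivWithinAt
      · intro s hs
        linarith [hL _ (hmem s (interior_subset hs)) v]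
    have h2 := h1.2 (x := 0) (by simp) (y := 1) (by simp) ha hb hab
    have hb' : b = 1 - a := by linarith
    simp only [smul_eq_mul, zero_smul, one_smul, add_zero, mul_zero, mul_one, zero_add] at h2
    rw [show x + v = y by simp [hv], show x + b • v = a • x + b • y by
      rw [hv, hb']; module] at h2
    have h3 : ‖a • x + b • y‖ ^ 2 = a * ‖x‖ ^ 2 + b * ‖y‖ ^ 2 - a * b * ‖v‖ ^ 2 := by
      rw [hv, norm_add_sq_real, norm_sub_sq_real, norm_smul, norm_smul, inner_smul_left,
        inner_smul_right, real_inner_comm x y, hb']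
      simp only [mul_pow, Real.norm_eq_abs, sq_abs, conj_trivial]
      ring
    simp only [smul_eq_mul]
    rw [h3]
    rw [hb'] at h2 ⊢
    ring_nf at h2 ⊢
    linarith
  have h := main.closure_of_continuousOn (ContinuousOn.sub (by fun_prop) huc)
  refine h.neg.congr fun x _ => ?_
  simp

end SecondDerivative

/-! ### Faces, boundary and interpolation in the triangulation. -/

section Triangulation

variable {d : ℕ} {K : Geometry.SimplicialComplex ℝ (EuclideanSpace ℝ (Fin d))}
  {Ω : Set (EuclideanSpace ℝ (Fin d))}

theorem isCompact_space (hK : K.faces.Finite) : IsCompact K.space :=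
  hK.isCompact_biUnion fun s _ => s.finite_toSet.isCompact_convexHull ℝ

theorem exists_face_pos_weights {y : EuclideanSpace ℝ (Fin d)} (hy : y ∈ K.space) :
    ∃ s ∈ K.faces, ∃ c : EuclideanSpace ℝ (Fin d) → ℝ, (∀ v ∈ s, 0 < c v) ∧ ∑ v ∈ s, c v = 1 ∧
      ∑ v ∈ s, c v • v = y := by
  classical
  obtain ⟨s, hs, hys⟩ := Geometry.SimplicialComplex.mem_space_iff.1 hy
  obtain ⟨c, hc0, hc1, hcy⟩ := Finset.mem_convexHull'.1 hys
  have h1 : ∑ v ∈ s with 0 < c v, c v = 1 := by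
    rw [Finset.sum_filter_of_ne, hc1]
    exact fun v hv hne => lt_of_le_of_ne (hc0 v hv) hne.symm
  refine ⟨s.filter fun v => 0 < c v, K.down_closed hs (Finset.filter_subset _ _) ?_, c,
    fun v hv => (Finset.mem_filter.1 hv).2, h1, ?_⟩
  · rw [Finset.nonempty_iff_ne_empty]
    intro h
    rw [h, Finset.sum_empty] at h1
    exact zero_ne_one h1
  · rw [Finset.sum_filter_of_ne, hcy]
    exact fun v hv hne => lt_of_le_of_ne (hc0 v hv) fun h => hne (by rw [← h, zero_smul])

/-- By uniqueness of barycentric coordinates, a point with all weights positive lies on no proper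
face. -/
theorem AffineIndependent.subset_of_mem_convexHull {E : Type*} [AddCommGroup E] [Module ℝ E]
    [DecidableEq E] {s s' : Finset E} (hs : AffineIndependent ℝ ((↑) : s → E)) (hss : s' ⊆ s)
    {c : E → ℝ} (hc : ∀ v ∈ s, 0 < c v) (hc1 : ∑ v ∈ s, c v = 1)
    (hmem : ∑ v ∈ s, c v • v ∈ convexHull ℝ (s' : Set E)) : s ⊆ s' := by
  obtain ⟨b, -, hb1, hb⟩ := Finset.mem_convexHull'.1 hmem
  set w : E → ℝ := fun v => c v - if v ∈ s' then b v else 0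
  have hw0 : ∑ v ∈ s, w v = 0 := by
    simp only [w, Finset.sum_sub_distrib, Finset.sum_ite_mem, Finset.inter_eq_right.2 hss, hc1, hb1,
      sub_self]
  have hw1 : ∑ v ∈ s, w v • v = 0 := by
    simp only [w, sub_smul, ite_smul, zero_smul, Finset.sum_sub_distrib, Finset.sum_ite_mem,
      Finset.inter_eq_right.2 hss, hb, sub_self]
  intro v hv
  by_contra hvs
  have := affineIndependent_iff.1 hs Finset.univ (fun x => w x)
    (by rw [← hw0]; exact Finset.sum_coe_sort s w)
    (by rw [← hw1]; exact Finset.sum_coe_sort s fun v => w v • v) ⟨v, hv⟩ (Finset.mem_univ _)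
  simp only [w, if_neg hvs, sub_zero] at this
  exact (hc v hv).ne' this

/-- If a vertex of the face carrying `y` is interior, then so is `y`. -/
theorem mem_interior_space_of_vertex (hK : K.faces.Finite) {s : Finset (EuclideanSpace ℝ (Fin d))}
    (hs : s ∈ K.faces) {c : EuclideanSpace ℝ (Fin d) → ℝ} (hc : ∀ v ∈ s, 0 < c v)
    (hc1 : ∑ v ∈ s, c v = 1) {v : EuclideanSpace ℝ (Fin d)} (hv : v ∈ s)
    (hvi : v ∈ interior K.space) : ∑ v ∈ s, c v • v ∈ interior K.space := by
  classical
  set y := ∑ v ∈ s, c v • v with hy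
  -- The point `p`, close to the interior vertex `v` on the segment towards `y`, is interior to the
  -- mesh and still has positive weights on all of `s`.
  obtain ⟨t, ht, ht1, hpt⟩ : ∃ t : ℝ, 0 < t ∧ t < 1 ∧ v + t • (y - v) ∈ interior K.space := by
    have h1 : ∀ᶠ t : ℝ in nhdsWithin 0 (Ioi 0), v + t • (y - v) ∈ interior K.space := by
      have : ContinuousAt (fun t : ℝ => v + t • (y - v)) 0 := by fun_prop
      refine (this.eventually_mem ?_).filter_mono nhdsWithin_le_nhds
      simpa using isOpen_interior.mem_nhds hvi
    have h2 : ∀ᶠ t : ℝ in nhdsWithin 0 (Ioi 0), t ∈ Ioo (0 : ℝ) 1 := Ioo_mem_nhdsGT one_pos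
    obtain ⟨t, h, h'⟩ := (h1.and h2).exists
    exact ⟨t, h'.1, h'.2, h⟩
  set p := v + t • (y - v) with hp
  set b : EuclideanSpace ℝ (Fin d) → ℝ := fun x => t * c x + if x = v then 1 - t else 0 with hb
  have hb0 : ∀ x ∈ s, 0 < b x := by
    intro x hx
    have := mul_pos ht (hc x hx)
    simp only [hb]
    split_ifs <;> linarith
  have hb1 : ∑ x ∈ s, b x = 1 := by
    simp only [hb, Finset.sum_add_distrib, ← Finset.mul_sum, hc1, Finset.sum_ite_eq', hv, if_true]
    ring
  have hbp : ∑ x ∈ s, b x • x = p := by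
    simp only [hb, add_smul, Finset.sum_add_distrib, mul_smul, ← Finset.smul_sum, ← hy, ite_smul,
      zero_smul, Finset.sum_ite_eq', hv, if_true, hp]
    module
  have hcv : c v ≤ 1 := hc1 ▸ Finset.single_le_sum (fun x hx => (hc x hx).le) hv
  -- With `a` this small, `y - a • p` keeps nonnegative weights, so `y = a • p + (1 - a) • r` with
  -- `r` in the hull of `s`.
  set a := c v / 2 with ha
  have ha0 : 0 < a := half_pos (hc v hv)
  have ha1 : a < 1 := by linarith
  set r := (1 - a)⁻¹ • (y - a • p) with hr
  have hrs : r ∈ convexHull ℝ (s : Set (EuclideanSpace ℝ (Fin d))) := by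
    have h1 : r = ∑ x ∈ s, ((1 - a)⁻¹ * (c x - a * b x)) • x := by
      simp only [mul_smul, ← Finset.smul_sum, sub_smul, Finset.sum_sub_distrib, hbp, ← hy, hr]
    rw [h1]
    refine (convex_convexHull ℝ _).sum_mem (fun x hx => ?_) ?_ fun x hx => subset_convexHull ℝ _ hx
    · refine mul_nonneg (inv_nonneg.2 (by linarith)) ?_
      have hcx := hc x hx
      have h2 : a * t ≤ 1 / 2 := by nlinarith
      simp only [hb]
      split_ifs with h
      · subst h; nlinarith
      · nlinarith
    · rw [← Finset.mul_sum, Finset.sum_sub_distrib, ← Finset.mul_sum, hc1, hb1, mul_one,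
        inv_mul_cancel₀ (by linarith)]
  -- Near `p` only faces containing `s` occur. Each contains `r`, so the homothety with centre `r`
  -- and ratio `a` maps `U` into the mesh and `p` to `y`.
  set U : Set (EuclideanSpace ℝ (Fin d)) := interior K.space ∩
    ⋂ T ∈ {T ∈ K.faces | ¬ s ⊆ T}, (convexHull ℝ (T : Set (EuclideanSpace ℝ (Fin d))))ᶜ with hU
  have hUo : IsOpen U := isOpen_interior.inter <|
    (hK.subset (sep_subset _ _)).isOpen_biInter fun T _ =>
      (T.finite_toSet.isCompact_convexHull ℝ).isClosed.isOpen_compl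
  have hpU : p ∈ U := by
    refine ⟨hpt, mem_iInter₂.2 fun T hT hpT => hT.2 ?_⟩
    have hps : p ∈ convexHull ℝ (s : Set (EuclideanSpace ℝ (Fin d))) := by
      rw [← hbp]
      exact (convex_convexHull ℝ _).sum_mem (fun x hx => (hb0 x hx).le) hb1
        fun x hx => subset_convexHull ℝ _ hx
    have h1 := K.inter_subset_convexHull hs hT.1 ⟨hps, hpT⟩
    rw [← Finset.coe_inter, ← hbp] at h1
    exact ((K.indep hs).subset_of_mem_convexHull Finset.inter_subset_left hb0 hb1 h1).trans
      Finset.inter_subset_right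
  rw [mem_interior]
  refine ⟨(fun x => p + a⁻¹ • (x - y)) ⁻¹' U, fun x hx => ?_, hUo.preimage (by fun_prop),
    by simpa using hpU⟩
  obtain ⟨T, hT, hqT⟩ := Geometry.SimplicialComplex.mem_space_iff.1 (interior_subset hx.1)
  have hsT : s ⊆ T := by
    by_contra h
    exact mem_iInter₂.1 hx.2 T ⟨hT, h⟩ hqT
  refine Geometry.SimplicialComplex.mem_space_iff.2 ⟨T, hT, ?_⟩
  have := (convex_convexHull ℝ (T : Set (EuclideanSpace ℝ (Fin d)))) hqT
    (convexHull_mono (Finset.coe_subset.2 hsT) hrs) ha0.le (sub_nonneg.2 ha1.le) (by ring)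
  convert this using 1
  rw [hr, smul_smul, mul_inv_cancel₀ (by linarith), one_smul, smul_add, smul_smul,
    mul_inv_cancel₀ ha0.ne', one_smul]
  abel

theorem mem_vertices_of_mem_face {s : Finset (EuclideanSpace ℝ (Fin d))} (hs : s ∈ K.faces)
    {v : EuclideanSpace ℝ (Fin d)} (hv : v ∈ s) : v ∈ K.vertices :=
  K.down_closed hs (Finset.singleton_subset_iff.2 hv) (Finset.singleton_nonempty v)

theorem mem_interiorNodes_or_mem_boundaryNodes (hK : K.faces.Finite)
    {v : EuclideanSpace ℝ (Fin d)} (hv : v ∈ K.vertices) :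
    v ∈ interiorNodes K ∨ v ∈ boundaryNodes K := by
  have hvs := K.vertices_subset_space hv
  by_cases h : v ∈ interior K.space
  · exact Or.inl ⟨hv, h⟩
  · refine Or.inr ⟨hv, ?_⟩
    rw [(isCompact_space hK).isClosed.frontier_eq]
    exact ⟨hvs, h⟩

theorem IsTriangulation.apply_eq_sum (hK : IsTriangulation Ω K)
    {w : EuclideanSpace ℝ (Fin d) → ℝ} (hw : IsPiecewiseLinear K w)
    {s : Finset (EuclideanSpace ℝ (Fin d))} (hs : s ∈ K.faces) {c : EuclideanSpace ℝ (Fin d) → ℝ}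
    (hc : ∀ v ∈ s, 0 ≤ c v) (hc1 : ∑ v ∈ s, c v = 1) :
    w (∑ v ∈ s, c v • v) = ∑ v ∈ s, c v * w v := by
  obtain ⟨T, hT, hsT⟩ := hK.pure s hs
  obtain ⟨A, hA⟩ := hw.affine T hT
  have hmem : ∀ v ∈ s, v ∈ convexHull ℝ (T : Set (EuclideanSpace ℝ (Fin d))) :=
    fun v hv => subset_convexHull ℝ _ (hsT hv)
  have hdec : ∀ x, A x = A.linear x + A 0 := fun x => congrFun A.decomp x
  have h1 : ∑ v ∈ s, c v * w v = ∑ v ∈ s, (c v * A.linear v + c v * A 0) :=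
    Finset.sum_congr rfl fun v hv => by rw [hA (hmem v hv), hdec, mul_add]
  rw [hA ((convex_convexHull ℝ _).sum_mem hc hc1 hmem), h1, hdec, Finset.sum_add_distrib,
    ← Finset.sum_mul, hc1, one_mul, map_sum]
  simp only [map_smul, smul_eq_mul]

theorem IsTriangulation.dist_le (hK : IsTriangulation Ω K) {h : ℝ} (hh : IsMeshSize K h)
    {s : Finset (EuclideanSpace ℝ (Fin d))} (hs : s ∈ K.faces) {c : EuclideanSpace ℝ (Fin d) → ℝ}
    (hc : ∀ v ∈ s, 0 ≤ c v) (hc1 : ∑ v ∈ s, c v = 1) {v : EuclideanSpace ℝ (Fin d)}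
    (hv : v ∈ s) : dist v (∑ v ∈ s, c v • v) ≤ h := by
  obtain ⟨T, hT, hsT⟩ := hK.pure s hs
  have hmem : ∀ v ∈ s, v ∈ convexHull ℝ (T : Set (EuclideanSpace ℝ (Fin d))) :=
    fun v hv => subset_convexHull ℝ _ (hsT hv)
  exact (Metric.dist_le_diam_of_mem (T.finite_toSet.isCompact_convexHull ℝ).isBounded (hmem v hv)
    ((convex_convexHull ℝ _).sum_mem hc hc1 hmem)).trans (hh.2 ⟨T, hT, rfl⟩)

theorem IsMeshSize.nonneg {h : ℝ} (hh : IsMeshSize K h) : 0 ≤ h := by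
  obtain ⟨T, -, hT⟩ := hh.1
  rw [← hT]
  exact Metric.diam_nonneg

/-- Interpolation error bound: a convex combination of nodal values exceeds the value of `φ` by at
most `L h² / 2` if `φ - L / 2 * ‖x‖²` is concave. -/
theorem IsTriangulation.sum_le_add (hK : IsTriangulation Ω K) {h : ℝ} (hh : IsMeshSize K h)
    {φ : EuclideanSpace ℝ (Fin d) → ℝ} {L : ℝ} (hL : 0 ≤ L)
    (hφ : ConcaveOn ℝ (closure Ω) fun x => φ x - L / 2 * ‖x‖ ^ 2)
    {s : Finset (EuclideanSpace ℝ (Fin d))} (hs : s ∈ K.faces) {c : EuclideanSpace ℝ (Fin d) → ℝ}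
    (hc : ∀ v ∈ s, 0 ≤ c v) (hc1 : ∑ v ∈ s, c v = 1) :
    ∑ v ∈ s, c v * φ v ≤ φ (∑ v ∈ s, c v • v) + L / 2 * h ^ 2 := by
  set y := ∑ v ∈ s, c v • v with hy
  have h1 := hφ.le_map_sum hc hc1 fun v hv => hK.space_subset (K.subset_space hs hv)
  simp only [smul_eq_mul, mul_sub, Finset.sum_sub_distrib, ← hy] at h1
  -- The Jensen gap of `‖x‖²` is the variance of the vertices about `y`, at most `h²`.
  have h2 : ∑ v ∈ s, c v * ‖v - y‖ ^ 2 = ∑ v ∈ s, c v * ‖v‖ ^ 2 - ‖y‖ ^ 2 := by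
    have : ∀ v ∈ s, c v * ‖v - y‖ ^ 2 =
        c v * ‖v‖ ^ 2 - 2 * inner ℝ (c v • v) y + c v * ‖y‖ ^ 2 := by
      intro v _
      rw [norm_sub_sq_real, inner_smul_left, conj_trivial]; ring
    rw [Finset.sum_congr rfl this, Finset.sum_add_distrib, Finset.sum_sub_distrib,
      ← Finset.sum_mul, hc1, ← Finset.mul_sum, ← sum_inner, ← hy, real_inner_self_eq_norm_sq]
    ring
  have h3 : ∑ v ∈ s, c v * ‖v - y‖ ^ 2 ≤ ∑ v ∈ s, c v * h ^ 2 := by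
    refine Finset.sum_le_sum fun v hv => mul_le_mul_of_nonneg_left ?_ (hc v hv)
    rw [← dist_eq_norm]
    have := hK.dist_le hh hs hc hc1 hv
    gcongr
  rw [← Finset.sum_mul, hc1, one_mul] at h3
  have h4 : ∑ v ∈ s, c v * (L / 2 * ‖v‖ ^ 2) = L / 2 * ∑ v ∈ s, c v * ‖v‖ ^ 2 := by
    rw [Finset.mul_sum]
    exact Finset.sum_congr rfl fun v _ => by ring
  rw [h4] at h1
  nlinarith

end Triangulation

/-! ### The truncated step. -/

section StepFraction

variable {d : ℕ} {D : Set (EuclideanSpace ℝ (Fin d))} {δ : ℝ} {x w : EuclideanSpace ℝ (Fin d)}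

theorem le_stepFraction {ρ : ℝ} (hρ : 0 < ρ) (hρ1 : ρ ≤ 1) (h1 : x + (ρ * δ) • w ∈ D)
    (h2 : x - (ρ * δ) • w ∈ D) : ρ ≤ stepFraction D δ x w :=
  le_csSup ⟨1, fun _ hr => hr.2.1⟩ ⟨hρ, hρ1, h1, h2⟩

theorem min_le_stepFraction {r : ℝ} (hδ : 0 < δ) (hr : 0 < r) (hball : Metric.closedBall x r ⊆ D)
    (hw : ‖w‖ = 1) : min 1 (r / δ) ≤ stepFraction D δ x w := by
  have h0 : 0 < min 1 (r / δ) := lt_min one_pos (by positivity)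
  have h1 : min 1 (r / δ) * δ ≤ r := (le_div_iff₀ hδ).1 (min_le_right _ _)
  have h2 : ‖(min 1 (r / δ) * δ) • w‖ ≤ r := by
    rw [norm_smul, hw, mul_one, Real.norm_of_nonneg (by positivity)]
    exact h1
  refine le_stepFraction h0 (min_le_left _ _) (hball ?_) (hball ?_)
  · simpa [dist_eq_norm] using h2
  · simpa [dist_eq_norm] using h2

theorem stepFraction_pos (hδ : 0 < δ) (hx : x ∈ interior D) (hw : ‖w‖ = 1) :
    0 < stepFraction D δ x w := by
  obtain ⟨r, hr, hball⟩ := Metric.nhds_basis_closedBall.mem_iff.1 (mem_interior_iff_mem_nhds.1 hx)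
  exact (lt_min one_pos (by positivity)).trans_le (min_le_stepFraction hδ hr hball hw)

theorem stepFraction_le_one : stepFraction D δ x w ≤ 1 :=
  Real.sSup_le (fun _ hr => hr.2.1) zero_le_one

theorem stepFraction_mem (hD : IsClosed D) (hδ : 0 < δ) (hx : x ∈ interior D) (hw : ‖w‖ = 1) :
    x + (stepFraction D δ x w * δ) • w ∈ D ∧ x - (stepFraction D δ x w * δ) • w ∈ D := by
  set S : Set ℝ := {ρ : ℝ | 0 < ρ ∧ ρ ≤ 1 ∧ x + (ρ * δ) • w ∈ D ∧ x - (ρ * δ) • w ∈ D} with hS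
  have hne : S.Nonempty := by
    by_contra h
    have := stepFraction_pos hδ hx hw
    -- The supremum of the empty set is 0 by convention, contradicting positivity.
    rw [stepFraction, ← hS, not_nonempty_iff_eq_empty.1 h, Real.sSup_empty] at this
    exact this.false
  have hcl : IsClosed {ρ : ℝ | x + (ρ * δ) • w ∈ D ∧ x - (ρ * δ) • w ∈ D} :=
    (hD.preimage (f := fun ρ : ℝ => x + (ρ * δ) • w) (by fun_prop)).inter
      (hD.preimage (f := fun ρ : ℝ => x - (ρ * δ) • w) (by fun_prop))
  have hsub : S ⊆ {ρ : ℝ | x + (ρ * δ) • w ∈ D ∧ x - (ρ * δ) • w ∈ D} :=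
    fun ρ hρ => ⟨hρ.2.2.1, hρ.2.2.2⟩
  exact hcl.closure_subset_iff.2 hsub (csSup_mem_closure hne ⟨1, fun _ hr => hr.2.1⟩)

/-- If the step is shorter than `δ` and both ends are interior, it could be lengthened. -/
theorem stepFraction_eq_one_or_mem_frontier (hD : IsClosed D) (hδ : 0 < δ) (hx : x ∈ interior D)
    (hw : ‖w‖ = 1) : stepFraction D δ x w = 1 ∨ x + (stepFraction D δ x w * δ) • w ∈ frontier D ∨
      x - (stepFraction D δ x w * δ) • w ∈ frontier D := by
  by_contra! hcon
  obtain ⟨h1, h2, h3⟩ := hcon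
  set ρ := stepFraction D δ x w with hρ
  have hlt : ρ < 1 := lt_of_le_of_ne stepFraction_le_one h1
  have hmem := stepFraction_mem hD hδ hx hw
  rw [hD.frontier_eq] at h2 h3
  have hi1 : x + (ρ * δ) • w ∈ interior D := by_contra fun h => h2 ⟨hmem.1, h⟩
  have hi2 : x - (ρ * δ) • w ∈ interior D := by_contra fun h => h3 ⟨hmem.2, h⟩
  have e1 : ∀ᶠ r in nhdsWithin ρ (Ioi ρ), x + (r * δ) • w ∈ interior D :=
    (ContinuousAt.eventually_mem (f := fun r : ℝ => x + (r * δ) • w) (by fun_prop)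
      (isOpen_interior.mem_nhds hi1)).filter_mono nhdsWithin_le_nhds
  have e2 : ∀ᶠ r in nhdsWithin ρ (Ioi ρ), x - (r * δ) • w ∈ interior D :=
    (ContinuousAt.eventually_mem (f := fun r : ℝ => x - (r * δ) • w) (by fun_prop)
      (isOpen_interior.mem_nhds hi2)).filter_mono nhdsWithin_le_nhds
  have e3 : ∀ᶠ r in nhdsWithin ρ (Ioi ρ), r ∈ Ioo ρ 1 := Ioo_mem_nhdsGT hlt
  obtain ⟨r, ⟨h4, h5⟩, h6⟩ := ((e1.and e2).and e3).exists
  have := le_stepFraction ((stepFraction_pos hδ hx hw).trans h6.1) h6.2.le (interior_subset h4)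
    (interior_subset h5)
  exact absurd h6.1 (not_lt.2 this)

end StepFraction

/-! ### Consistency of second differences for `C^{2,α}` functions. -/

section Regularity

variable {d : ℕ} {Ω : Set (EuclideanSpace ℝ (Fin d))} {α : ℝ≥0}
  {u : EuclideanSpace ℝ (Fin d) → ℝ}

theorem IsC2Holder.norm_sub_le (hu : IsC2Holder Ω α u) {x y : EuclideanSpace ℝ (Fin d)}
    (hx : x ∈ Ω) (hy : y ∈ Ω) :
    ‖fderiv ℝ (fderiv ℝ u) x - fderiv ℝ (fderiv ℝ u) y‖ ≤
      seminormC2Holder Ω α u * dist x y ^ (α : ℝ) := by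
  have := hu.memHolder.holderWith.dist_le ⟨x, hx⟩ ⟨y, hy⟩
  rwa [dist_eq_norm] at this

/-- `nnHolderNorm` takes the value 0 on functions that are not Hölder, so the gradient must first be
shown Lipschitz: its derivative is Hölder on a bounded set, hence bounded, and `Ω` is convex. -/
theorem IsC2Holder.norm_le (hΩ : IsOpen Ω) (hconv : Convex ℝ Ω) (hbdd : Bornology.IsBounded Ω)
    (hu : IsC2Holder Ω α u) {x : EuclideanSpace ℝ (Fin d)} (hx : x ∈ Ω) :
    ‖fderiv ℝ (fderiv ℝ u) x‖ ≤ seminormC11 Ω u := by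
  have hdiff : ∀ y ∈ Ω, DifferentiableAt ℝ (fderiv ℝ u) y := fun y hy =>
    differentiableAt_fderiv_of_contDiffOn hΩ hu.contDiffOn hy
  set C : ℝ := ‖fderiv ℝ (fderiv ℝ u) x‖ + seminormC2Holder Ω α u * Metric.diam Ω ^ (α : ℝ)
    with hC
  have hH : 0 ≤ seminormC2Holder Ω α u := NNReal.coe_nonneg _
  have hC0 : 0 ≤ C := by positivity
  have hb : ∀ y ∈ Ω, ‖fderiv ℝ (fderiv ℝ u) y‖ ≤ C := by
    intro y hy
    have h1 := hu.norm_sub_le hy hx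
    have h2 : dist y x ^ (α : ℝ) ≤ Metric.diam Ω ^ (α : ℝ) :=
      Real.rpow_le_rpow dist_nonneg (Metric.dist_le_diam_of_mem hbdd hy hx) α.2
    have h3 := norm_sub_norm_le (fderiv ℝ (fderiv ℝ u) y) (fderiv ℝ (fderiv ℝ u) x)
    have h4 := mul_le_mul_of_nonneg_left h2 hH
    rw [hC]; linarith
  have hlip : LipschitzOnWith C.toNNReal (fderiv ℝ u) Ω :=
    hconv.lipschitzOnWith_of_nnnorm_fderiv_le hdiff fun y hy => by
      rw [← NNReal.coe_le_coe, coe_nnnorm, Real.coe_toNNReal _ hC0]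
      exact hb y hy
  have hmem : MemHolder 1 (Ω.domRestrict (fderiv ℝ u)) :=
    (holderWith_one.2 (lipschitzOnWith_iff_restrict.1 hlip)).memHolder
  have hlip' : LipschitzOnWith (nnHolderNorm 1 (Ω.domRestrict (fderiv ℝ u))) (fderiv ℝ u) Ω :=
    lipschitzOnWith_iff_restrict.2 (holderWith_one.1 hmem.holderWith)
  exact norm_fderiv_le_of_lipschitzOn ℝ (hΩ.mem_nhds hx) hlip'

theorem IsC2Holder.abs_apply_le (hΩ : IsOpen Ω) (hconv : Convex ℝ Ω)
    (hbdd : Bornology.IsBounded Ω) (hu : IsC2Holder Ω α u) {x : EuclideanSpace ℝ (Fin d)}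
    (hx : x ∈ Ω) (v : EuclideanSpace ℝ (Fin d)) :
    |fderiv ℝ (fderiv ℝ u) x v v| ≤ seminormC11 Ω u * ‖v‖ ^ 2 := by
  calc |fderiv ℝ (fderiv ℝ u) x v v| ≤ ‖fderiv ℝ (fderiv ℝ u) x‖ * ‖v‖ * ‖v‖ :=
        (fderiv ℝ (fderiv ℝ u) x).le_opNorm₂ v v
    _ ≤ seminormC11 Ω u * ‖v‖ * ‖v‖ := by
        have := hu.norm_le hΩ hconv hbdd hx
        gcongr
    _ = _ := by ring

theorem IsC2Holder.second_difference_mem (hΩ : IsOpen Ω) (hconv : Convex ℝ Ω)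
    (hu : IsC2Holder Ω α u) {z w : EuclideanSpace ℝ (Fin d)} {t δ : ℝ} (ht : 0 < t) (htδ : t ≤ δ)
    (hw : ‖w‖ = 1) (hz : z ∈ Ω) (h1 : z + t • w ∈ closure Ω) (h2 : z - t • w ∈ closure Ω) :
    u (z + t • w) - 2 * u z + u (z - t • w) ∈
      Icc ((fderiv ℝ (fderiv ℝ u) z w w - δ ^ (α : ℝ) * seminormC2Holder Ω α u) * t ^ 2)
        ((fderiv ℝ (fderiv ℝ u) z w w + δ ^ (α : ℝ) * seminormC2Holder Ω α u) * t ^ 2) := by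
  refine second_difference_bounds hΩ hconv hu.contDiffOn hu.continuousOn ht hz h1 h2 fun s hs => ?_
  have hmem := hconv.add_smul_mem_of_mem_closure hΩ ht hz h1 h2 hs
  have hH : 0 ≤ seminormC2Holder Ω α u := NNReal.coe_nonneg _
  have h3 := hu.norm_sub_le hmem hz
  have h4 : dist (z + s • w) z ≤ δ := by
    rw [dist_eq_norm, add_sub_cancel_left, norm_smul, hw, mul_one, Real.norm_eq_abs]
    exact (abs_lt.2 hs).le.trans htδ
  have h5 : dist (z + s • w) z ^ (α : ℝ) ≤ δ ^ (α : ℝ) := Real.rpow_le_rpow dist_nonneg h4 α.2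
  have h6 : |(fderiv ℝ (fderiv ℝ u) (z + s • w) - fderiv ℝ (fderiv ℝ u) z) w w| ≤
      ‖fderiv ℝ (fderiv ℝ u) (z + s • w) - fderiv ℝ (fderiv ℝ u) z‖ * ‖w‖ * ‖w‖ :=
    (fderiv ℝ (fderiv ℝ u) (z + s • w) - fderiv ℝ (fderiv ℝ u) z).le_opNorm₂ w w
  rw [hw, mul_one, mul_one, sub_apply, sub_apply, abs_le] at h6
  have h7 := mul_le_mul_of_nonneg_left h5 hH
  constructor <;> linarith [h6.1, h6.2]

end Regularity

/-! ### Discrete comparison with the barriers. -/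

section ErrorEstimate

variable {d : ℕ} {K : Geometry.SimplicialComplex ℝ (EuclideanSpace ℝ (Fin d))}
  {Ω : Set (EuclideanSpace ℝ (Fin d))} {V : Set (Fin d → EuclideanSpace ℝ (Fin d))}
  {f g u uh : EuclideanSpace ℝ (Fin d) → ℝ} {δ θ h R : ℝ} {α : ℝ≥0}

theorem exists_isMax_interiorNode (hK : K.faces.Finite) {F : EuclideanSpace ℝ (Fin d) → ℝ} {m : ℝ}
    (hb : ∀ v ∈ boundaryNodes K, F v ≤ m) (hex : ∃ v ∈ K.vertices, m < F v) :
    ∃ z ∈ interiorNodes K, m < F z ∧ ∀ v ∈ K.vertices, F v ≤ F z := by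
  have hfin : K.vertices.Finite := hK.preimage Finset.singleton_injective.injOn
  obtain ⟨v, hv, hmv⟩ := hex
  obtain ⟨z, hz, hmax⟩ := Set.exists_max_image K.vertices F hfin ⟨v, hv⟩
  have hmz : m < F z := hmv.trans_le (hmax v hv)
  refine ⟨z, ?_, hmz, hmax⟩
  exact (mem_interiorNodes_or_mem_boundaryNodes hK hz).resolve_right
    fun h => absurd (hb z h) (not_le.2 hmz)

theorem IsTriangulation.interior_space_subset (hΩ : IsOpen Ω) (hconv : Convex ℝ Ω)
    (hK : IsTriangulation Ω K) : interior K.space ⊆ Ω := by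
  intro x hx
  have hx' := interior_mono hK.space_subset hx
  have hne : (interior Ω).Nonempty := by
    rw [hΩ.interior_eq]
    exact closure_nonempty_iff.1 ⟨x, interior_subset hx'⟩
  rwa [hconv.interior_closure_eq_interior_of_nonempty_interior hne, hΩ.interior_eq] at hx'

theorem norm_sq_second_difference {z w : EuclideanSpace ℝ (Fin d)} {t : ℝ} (hw : ‖w‖ = 1) :
    ‖z + t • w‖ ^ 2 - 2 * ‖z‖ ^ 2 + ‖z - t • w‖ ^ 2 = 2 * t ^ 2 := by
  rw [norm_add_sq_real, norm_sub_sq_real, norm_smul, hw, mul_one, Real.norm_eq_abs, sq_abs]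
  ring

theorem IsDirectionDiscretization.nonempty (hV : IsDirectionDiscretization V θ) : V.Nonempty := by
  obtain ⟨W, hW, -⟩ := hV.approx _ (EuclideanSpace.basisFun (Fin d) ℝ).orthonormal
  exact ⟨W, hW⟩

/-- For infinite `V` an infimum over an unbounded family would have a default value. A ball around
`x` bounds the steps from below uniformly in the direction. -/
theorem bddBelow_twoScaleOperator (hK : K.faces.Finite) (hδ : 0 < δ)
    (hV : IsDirectionDiscretization V θ) {v : EuclideanSpace ℝ (Fin d) → ℝ}
    (hv : ContinuousOn v K.space) {x : EuclideanSpace ℝ (Fin d)} (hx : x ∈ interior K.space) :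
    BddBelow (range fun W : V =>
      (∏ i, max (secondDifference K.space δ v x (W.1 i)) 0) -
        ∑ i, max (-secondDifference K.space δ v x (W.1 i)) 0) := by
  have hcomp := isCompact_space hK
  obtain ⟨b, hb⟩ := hcomp.exists_bound_of_continuousOn hv
  obtain ⟨r, hr, hball⟩ := Metric.nhds_basis_closedBall.mem_iff.1 (mem_interior_iff_mem_nhds.1 hx)
  have hxK := interior_subset hx
  have hb0 : 0 ≤ b := (norm_nonneg _).trans (hb x hxK)
  set ρ := min 1 (r / δ) with hρ
  have hρ0 : 0 < ρ := lt_min one_pos (by positivity)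
  refine ⟨-(d * (4 * b / (ρ ^ 2 * δ ^ 2))), ?_⟩
  rintro _ ⟨W, rfl⟩
  have hprod : 0 ≤ ∏ i, max (secondDifference K.space δ v x (W.1 i)) 0 :=
    Finset.prod_nonneg fun i _ => le_max_right _ _
  have hsum : ∑ i, max (-secondDifference K.space δ v x (W.1 i)) 0 ≤
      ∑ _i : Fin d, 4 * b / (ρ ^ 2 * δ ^ 2) := by
    refine Finset.sum_le_sum fun i _ => max_le ?_ (by positivity)
    have hW := hV.unit W.1 W.2 i
    have hle := min_le_stepFraction hδ hr hball hW
    have hmem := stepFraction_mem hcomp.isClosed hδ hx hW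
    rw [← hρ] at hle
    rw [secondDifference, ← neg_div]
    set τ := stepFraction K.space δ x (W.1 i)
    have h1 := abs_le.1 (hb _ hmem.1)
    have h2 := abs_le.1 (hb _ hmem.2)
    have h3 := abs_le.1 (hb _ hxK)
    calc -(v (x + (τ * δ) • W.1 i) - 2 * v x + v (x - (τ * δ) • W.1 i)) / (τ ^ 2 * δ ^ 2)
        ≤ 4 * b / (τ ^ 2 * δ ^ 2) := by
          gcongr
          linarith [h1.1, h2.1, h3.2]
      _ ≤ 4 * b / (ρ ^ 2 * δ ^ 2) := by gcongr
  rw [Finset.sum_const, Finset.card_univ, Fintype.card_fin, nsmul_eq_mul] at hsum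
  show _ ≤ _ - _
  linarith

theorem lower_bound (hd : 0 < d) (hΩ : IsOpen Ω) (hconv : Convex ℝ Ω)
    (hbdd : Bornology.IsBounded Ω) (hR : closure Ω ⊆ Metric.closedBall 0 R)
    (hK : IsTriangulation Ω K) (hδ : 0 < δ) (hθ0 : 0 < θ) (hθ : θ ≤ 1 / (4 * (d : ℝ)))
    (hV : IsDirectionDiscretization V θ) (hu : IsC2Holder Ω α u) (hMA : SolvesMongeAmpere Ω f g u)
    (hTS : SolvesTwoScale K δ V f g uh) {η : ℝ} (hη : 0 < η) {y : EuclideanSpace ℝ (Fin d)}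
    (hy : y ∈ K.space) :
    u y - (δ ^ (α : ℝ) * seminormC2Holder Ω α u + 13 * d * θ ^ 2 * seminormC11 Ω u + 2 * η) / 2 *
      R ^ 2 ≤ uh y := by
  have hL : 0 ≤ seminormC11 Ω u := NNReal.coe_nonneg _
  have hH : 0 ≤ seminormC2Holder Ω α u := NNReal.coe_nonneg _
  set L := seminormC11 Ω u
  set H := seminormC2Holder Ω α u
  set M := δ ^ (α : ℝ) * H + 13 * d * θ ^ 2 * L + 2 * η with hM
  have hM0 : 0 ≤ M := by positivity
  have hRy : ∀ x ∈ closure Ω, ‖x‖ ^ 2 ≤ R ^ 2 := fun x hx => by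
    have := hR hx
    rw [mem_closedBall_zero_iff] at this
    gcongr
  set φ : EuclideanSpace ℝ (Fin d) → ℝ := fun x => u x + M / 2 * (‖x‖ ^ 2 - R ^ 2) with hφ
  have hφconv : ConvexOn ℝ (closure Ω) φ := by
    have h1 := hMA.convexOn.closure_of_continuousOn hu.continuousOn
    have h2 : ConvexOn ℝ (closure Ω) fun x : EuclideanSpace ℝ (Fin d) => ‖x‖ ^ 2 :=
      (convexOn_norm hconv.closure).pow (fun _ _ => norm_nonneg _) 2
    exact h1.add ((h2.sub (concaveOn_const (R ^ 2) hconv.closure)).smul (c := M / 2) (by positivity))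
  -- Convexity of `φ` carries a nodal inequality to the whole mesh without loss. At the maximal
  -- node, `φ - m` then touches `uh` from below and second differences compare.
  have hjensen : ∀ m : ℝ, (∀ v ∈ K.vertices, φ v - uh v ≤ m) → ∀ y ∈ K.space, φ y - m ≤ uh y := by
    intro m hm y hy
    obtain ⟨s, hs, c, hc, hc1, rfl⟩ := exists_face_pos_weights hy
    have hc' : ∀ v ∈ s, 0 ≤ c v := fun v hv => (hc v hv).le
    rw [hK.apply_eq_sum hTS.piecewiseLinear hs hc' hc1]
    have h1 := hφconv.map_sum_le hc' hc1 fun v hv => hK.space_subset (K.subset_space hs hv)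
    have h2 : ∑ v ∈ s, c v * (φ v - m) ≤ ∑ v ∈ s, c v * uh v :=
      Finset.sum_le_sum fun v hv => mul_le_mul_of_nonneg_left
        (by linarith [hm v (mem_vertices_of_mem_face hs hv)]) (hc' v hv)
    simp only [mul_sub, Finset.sum_sub_distrib, ← Finset.sum_mul, hc1, one_mul] at h2
    simp only [smul_eq_mul] at h1
    linarith
  have hnodes : ∀ v ∈ K.vertices, φ v - uh v ≤ 0 := by
    by_contra! hcon
    have hbd : ∀ v ∈ boundaryNodes K, φ v - uh v ≤ 0 := by
      intro v hv
      have h1 := hMA.boundary v (hK.boundaryNodes_subset hv)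
      have h2 := hTS.boundary v hv
      have h3 := hRy v (hK.space_subset (K.vertices_subset_space hv.1))
      have h4 := mul_nonneg (half_pos (by positivity : 0 < M)).le (sub_nonneg.2 h3)
      simp only [hφ]
      rw [h1, h2]
      linarith
    obtain ⟨z, hz, -, hmax⟩ := exists_isMax_interiorNode hK.finite hbd hcon
    have hzΩ := hK.interior_space_subset hΩ hconv hz.2
    have hle := hjensen _ hmax
    have hcl := (isCompact_space hK.finite).isClosed
    set B := fderiv ℝ (fderiv ℝ u) z
    have hSD : ∀ w : EuclideanSpace ℝ (Fin d), ‖w‖ = 1 →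
        B w w + 13 * d * θ ^ 2 * L + 2 * η ≤ secondDifference K.space δ uh z w := by
      intro w hw
      have hρ := stepFraction_pos hδ hz.2 hw
      have hmem := stepFraction_mem hcl hδ hz.2 hw
      have hρ1 : stepFraction K.space δ z w ≤ 1 := stepFraction_le_one
      rw [secondDifference]
      set ρ := stepFraction K.space δ z w
      have ht : 0 < ρ * δ := by positivity
      have hcons := (hu.second_difference_mem hΩ hconv ht (by nlinarith : ρ * δ ≤ δ) hw hzΩ
        (hK.space_subset hmem.1) (hK.space_subset hmem.2)).1
      have hq := norm_sq_second_difference (z := z) (t := ρ * δ) hw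
      have h1 := hle _ hmem.1
      have h2 := hle _ hmem.2
      simp only [hφ] at h1 h2
      rw [← mul_pow, le_div_iff₀ (by positivity)]
      have hq' : M / 2 * (‖z + (ρ * δ) • w‖ ^ 2 - 2 * ‖z‖ ^ 2 + ‖z - (ρ * δ) • w‖ ^ 2) =
          M * (ρ * δ) ^ 2 := by rw [hq]; ring
      have hfin : (B w w - δ ^ (α : ℝ) * H) * (ρ * δ) ^ 2 + M * (ρ * δ) ^ 2 =
          (B w w + 13 * d * θ ^ 2 * L + 2 * η) * (ρ * δ) ^ 2 := by rw [hM]; ring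
      rw [← hfin]
      linarith
    have hT := hTS.interior z hz
    have : Nonempty V := hV.nonempty.to_subtype
    have hge : f z + η ^ d ≤ twoScaleOperator K δ V uh z := by
      refine le_ciInf fun W => ?_
      obtain ⟨w, hw, hwW⟩ := hV.near W.1 W.2
      have hBpos : ∀ x, 0 ≤ B x x := hMA.convexOn.fderiv_fderiv_nonneg hΩ hu.contDiffOn hzΩ
      have hpos : ∀ i, 0 ≤ secondDifference K.space δ uh z (W.1 i) := fun i => by
        have := hSD _ (hV.unit W.1 W.2 i)
        have h2 : 0 ≤ 13 * d * θ ^ 2 * L := by positivity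
        linarith [hBpos (W.1 i)]
      have key := det_add_pow_le_prod (B := B)
        (fderiv_fderiv_symm_of_contDiffOn hΩ hu.contDiffOn hzΩ) hBpos
        (fun x => (abs_le.1 (hu.abs_apply_le hΩ hconv hbdd hzΩ x)).2) hd hθ0.le hθ hη hw
        (hV.unit W.1 W.2) hwW fun i => hSD _ (hV.unit W.1 W.2 i)
      rw [← hMA.det_eq z hzΩ]
      rw [Finset.prod_congr rfl fun i _ => max_eq_left (hpos i),
        Finset.sum_eq_zero fun i _ => max_eq_right (neg_nonpos.2 (hpos i)), sub_zero]
      exact key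
    have := pow_pos hη d
    linarith
  have := hjensen 0 hnodes y hy
  have h2 : 0 ≤ M / 2 * ‖y‖ ^ 2 := by positivity
  simp only [hφ] at this
  linarith

theorem upper_bound (hd : 0 < d) (hΩ : IsOpen Ω) (hconv : Convex ℝ Ω)
    (hbdd : Bornology.IsBounded Ω) (hR : closure Ω ⊆ Metric.closedBall 0 R)
    (hK : IsTriangulation Ω K) (hh : IsMeshSize K h) (hδ : 0 < δ)
    (hV : IsDirectionDiscretization V θ) (hu : IsC2Holder Ω α u) (hMA : SolvesMongeAmpere Ω f g u)
    (hTS : SolvesTwoScale K δ V f g uh) {η : ℝ} (hη : 0 < η) {y : EuclideanSpace ℝ (Fin d)}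
    (hy : y ∈ K.space) :
    uh y ≤ u y + (δ ^ (α : ℝ) * seminormC2Holder Ω α u +
      (2 * θ ^ 2 + h ^ 2 * (δ ^ 2)⁻¹) * seminormC11 Ω u + η) / 2 * R ^ 2 +
      3 / 2 * h ^ 2 * seminormC11 Ω u := by
  have hL : 0 ≤ seminormC11 Ω u := NNReal.coe_nonneg _
  have hH : 0 ≤ seminormC2Holder Ω α u := NNReal.coe_nonneg _
  set L := seminormC11 Ω u
  set H := seminormC2Holder Ω α u
  set M := δ ^ (α : ℝ) * H + (2 * θ ^ 2 + h ^ 2 * (δ ^ 2)⁻¹) * L + η with hM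
  have hM0 : 0 ≤ M := by positivity
  have hRy : ∀ x ∈ closure Ω, ‖x‖ ^ 2 ≤ R ^ 2 := fun x hx => by
    have := hR hx
    rw [mem_closedBall_zero_iff] at this
    gcongr
  set φ : EuclideanSpace ℝ (Fin d) → ℝ := fun x => u x + M / 2 * (R ^ 2 - ‖x‖ ^ 2) with hφ
  have huφ : ∀ x ∈ closure Ω, u x ≤ φ x := fun x hx => by
    have := mul_nonneg (half_pos (by positivity : 0 < M)).le (sub_nonneg.2 (hRy x hx))
    simp only [hφ]
    linarith
  have huconc := concaveOn_sub_norm_sq hΩ hconv hu.contDiffOn hu.continuousOn (L := L)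
    fun x hx v => (abs_le.1 (hu.abs_apply_le hΩ hconv hbdd hx v)).2
  have hφconc : ConcaveOn ℝ (closure Ω) fun x => φ x - L / 2 * ‖x‖ ^ 2 := by
    have h2 : ConvexOn ℝ (closure Ω) fun x : EuclideanSpace ℝ (Fin d) => ‖x‖ ^ 2 :=
      (convexOn_norm hconv.closure).pow (fun _ _ => norm_nonneg _) 2
    refine (huconc.add (((concaveOn_const (R ^ 2) hconv.closure).sub h2).smul (c := M / 2)
      (by positivity))).congr fun x _ => ?_
    simp only [hφ, Pi.add_apply, Pi.sub_apply, smul_eq_mul]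
    ring
  have hjensen : ∀ m : ℝ, (∀ v ∈ K.vertices, uh v - φ v ≤ m) →
      ∀ y ∈ K.space, uh y ≤ φ y + m + L / 2 * h ^ 2 := by
    intro m hm y hy
    obtain ⟨s, hs, c, hc, hc1, rfl⟩ := exists_face_pos_weights hy
    have hc' : ∀ v ∈ s, 0 ≤ c v := fun v hv => (hc v hv).le
    rw [hK.apply_eq_sum hTS.piecewiseLinear hs hc' hc1]
    have h1 := hK.sum_le_add hh hL hφconc hs hc' hc1
    have h2 : ∑ v ∈ s, c v * uh v ≤ ∑ v ∈ s, c v * (φ v + m) :=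
      Finset.sum_le_sum fun v hv => mul_le_mul_of_nonneg_left
        (by linarith [hm v (mem_vertices_of_mem_face hs hv)]) (hc' v hv)
    simp only [mul_add, Finset.sum_add_distrib, ← Finset.sum_mul, hc1, one_mul] at h2
    linarith
  have hbdNode : ∀ v ∈ boundaryNodes K, uh v = u v := fun v hv => by
    rw [hTS.boundary v hv, hMA.boundary v (hK.boundaryNodes_subset hv)]
  -- By `mem_interior_space_of_vertex`, the face carrying a frontier point has only boundary nodes
  -- as vertices, where `uh = u`.
  have hfront : ∀ y ∈ frontier K.space, uh y ≤ u y + L / 2 * h ^ 2 := by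
    intro y hy
    have hcl := (isCompact_space hK.finite).isClosed
    rw [hcl.frontier_eq] at hy
    obtain ⟨s, hs, c, hc, hc1, rfl⟩ := exists_face_pos_weights hy.1
    have hc' : ∀ v ∈ s, 0 ≤ c v := fun v hv => (hc v hv).le
    rw [hK.apply_eq_sum hTS.piecewiseLinear hs hc' hc1]
    refine le_trans (le_of_eq (Finset.sum_congr rfl fun v hv => ?_))
      (hK.sum_le_add hh hL huconc hs hc' hc1)
    rw [hbdNode]
    refine (mem_interiorNodes_or_mem_boundaryNodes hK.finite
      (mem_vertices_of_mem_face hs hv)).resolve_left fun hvi => hy.2 ?_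
    exact mem_interior_space_of_vertex hK.finite hs hc hc1 hv hvi.2
  -- The threshold `L h²` is what lets shortened steps be treated without dividing the interpolation
  -- error by `ρ²`.
  have hnodes : ∀ v ∈ K.vertices, uh v - φ v ≤ L * h ^ 2 := by
    by_contra! hcon
    have hbd : ∀ v ∈ boundaryNodes K, uh v - φ v ≤ L * h ^ 2 := by
      intro v hv
      have h1 := huφ v (hK.space_subset (K.vertices_subset_space hv.1))
      have h2 : 0 ≤ L * h ^ 2 := by positivity
      rw [hbdNode v hv]
      linarith
    obtain ⟨z, hz, hmz, hmax⟩ := exists_isMax_interiorNode hK.finite hbd hcon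
    have hzΩ := hK.interior_space_subset hΩ hconv hz.2
    have hle := hjensen _ hmax
    have hcl := (isCompact_space hK.finite).isClosed
    set B := fderiv ℝ (fderiv ℝ u) z
    have hSD : ∀ w : EuclideanSpace ℝ (Fin d), ‖w‖ = 1 →
        secondDifference K.space δ uh z w + η ≤ B w w - 2 * θ ^ 2 * L := by
      intro w hw
      have hρ := stepFraction_pos hδ hz.2 hw
      have hmem := stepFraction_mem hcl hδ hz.2 hw
      have hρ1 : stepFraction K.space δ z w ≤ 1 := stepFraction_le_one
      have hcase := stepFraction_eq_one_or_mem_frontier hcl hδ hz.2 hw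
      rw [secondDifference]
      set ρ := stepFraction K.space δ z w
      have ht : 0 < ρ * δ := by positivity
      have hcons := (hu.second_difference_mem hΩ hconv ht (by nlinarith : ρ * δ ≤ δ) hw hzΩ
        (hK.space_subset hmem.1) (hK.space_subset hmem.2)).2
      have hq := norm_sq_second_difference (z := z) (t := ρ * δ) hw
      have h1 := hle _ hmem.1
      have h2 := hle _ hmem.2
      -- A full step loses `L h² / 2` at each end. For a shortened step, with `m` the maximum of `uh
      -- - φ` at nodes, the frontier end exceeds `φ` by at most `L h² / 2` and the other by `m + L
      -- h² / 2`; the total `m + L h²` is below `2m`, so nothing is lost.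
      have herr : uh (z + (ρ * δ) • w) - 2 * uh z + uh (z - (ρ * δ) • w) ≤
          φ (z + (ρ * δ) • w) - 2 * φ z + φ (z - (ρ * δ) • w) +
            h ^ 2 * (δ ^ 2)⁻¹ * L * (ρ * δ) ^ 2 := by
        have hpos : 0 ≤ h ^ 2 * (δ ^ 2)⁻¹ * L * (ρ * δ) ^ 2 := by positivity
        rcases hcase with hc | hc | hc
        · have : h ^ 2 * (δ ^ 2)⁻¹ * L * (ρ * δ) ^ 2 = h ^ 2 * L := by
            rw [hc]; field_simp
          linarith
        · have h3 := hfront _ hc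
          have h4 := huφ _ (hK.space_subset hmem.1)
          linarith
        · have h3 := hfront _ hc
          have h4 := huφ _ (hK.space_subset hmem.2)
          linarith
      simp only [hφ] at herr
      have hq' : M / 2 * (‖z + (ρ * δ) • w‖ ^ 2 - 2 * ‖z‖ ^ 2 + ‖z - (ρ * δ) • w‖ ^ 2) =
          M * (ρ * δ) ^ 2 := by rw [hq]; ring
      have hfin : (B w w + δ ^ (α : ℝ) * H) * (ρ * δ) ^ 2 - M * (ρ * δ) ^ 2 +
          h ^ 2 * (δ ^ 2)⁻¹ * L * (ρ * δ) ^ 2 =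
          (B w w - 2 * θ ^ 2 * L - η) * (ρ * δ) ^ 2 := by rw [hM]; ring
      rw [← le_sub_iff_add_le, ← mul_pow, div_le_iff₀ (by positivity), ← hfin]
      linarith
    have hT := hTS.interior z hz
    have hdet : (bilinMatrix B).det = f z := hMA.det_eq z hzΩ
    obtain ⟨w, hw, hkey⟩ := exists_orthonormal_prod_sub_sum_lt_det (B := B)
      (fderiv_fderiv_symm_of_contDiffOn hΩ hu.contDiffOn hzΩ)
      (hu.abs_apply_le hΩ hconv hbdd hzΩ) hd (hdet ▸ hMA.nonneg z hzΩ)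
    obtain ⟨W, hW, hwW⟩ := hV.approx w hw
    have hlt := hkey θ η W (fun i => secondDifference K.space δ uh z (W i)) hη (hV.unit W hW) hwW
      fun i => hSD _ (hV.unit W hW i)
    have hinf : twoScaleOperator K δ V uh z ≤ _ := ciInf_le
      (bddBelow_twoScaleOperator hK.finite hδ hV hTS.piecewiseLinear.continuousOn hz.2) ⟨W, hW⟩
    rw [hT] at hinf
    rw [hdet] at hlt
    exact absurd (hinf.trans_lt hlt) (lt_irrefl _)
  have := hjensen _ hnodes y hy
  have h2 : 0 ≤ M / 2 * ‖y‖ ^ 2 := by positivity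
  simp only [hφ] at this
  linarith

end ErrorEstimate

theorem mainTheorem3 (d : ℕ) (hd : 0 < d) (Ω : Set (EuclideanSpace ℝ (Fin d)))
    (hΩ_open : IsOpen Ω) (hΩ_convex : Convex ℝ Ω) (hΩ_bounded : Bornology.IsBounded Ω) (σ : ℝ) :
    ∃ C : ℝ, 0 < C ∧
      ∀ (K : Geometry.SimplicialComplex ℝ (EuclideanSpace ℝ (Fin d))) (h ν : ℝ),
        IsTriangulation Ω K → IsMeshSize K h → IsShapeRegular K σ → IsQuasiUniform K h ν →
      ∀ (δ θ : ℝ) (V : Set (Fin d → EuclideanSpace ℝ (Fin d))),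
        0 < δ → 0 < θ → θ ≤ 1 / (4 * (d : ℝ)) → IsDirectionDiscretization V θ →
      ∀ (α : ℝ≥0) (f g u uh : EuclideanSpace ℝ (Fin d) → ℝ),
        0 < α → α ≤ 1 → IsC2Holder Ω α u → SolvesMongeAmpere Ω f g u →
        SolvesTwoScale K δ V f g uh →
      ∀ x ∈ K.space,
        |u x - uh x| ≤
          C * ((h ^ 2 * (1 + (δ ^ 2)⁻¹) + θ ^ 2) * seminormC11 Ω u +
            δ ^ (α : ℝ) * seminormC2Holder Ω α u) := by
  obtain ⟨R, hR⟩ := hΩ_bounded.closure.subset_closedBall (0 : EuclideanSpace ℝ (Fin d))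
  -- The 7 covers `13/2` from the barrier in `lower_bound`, and the 2 covers `3/2` from
  -- interpolation in `upper_bound`.
  refine ⟨7 * d * R ^ 2 + 2, by positivity, ?_⟩
  intro K h ν hK hh _ _ δ θ V hδ hθ0 hθ hV α f g u uh _ _ hu hMA hTS x hx
  have hL : 0 ≤ seminormC11 Ω u := NNReal.coe_nonneg _
  have hH : 0 ≤ seminormC2Holder Ω α u := NNReal.coe_nonneg _
  have hd1 : (1 : ℝ) ≤ d := by exact_mod_cast hd
  refine le_of_forall_pos_le_add fun ε hε => ?_
  set η := ε / (R ^ 2 + 1) with hη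
  have hη0 : 0 < η := by positivity
  have hηR : η * R ^ 2 ≤ ε := by
    rw [hη, div_mul_eq_mul_div, div_le_iff₀ (by positivity)]
    nlinarith
  have lo := lower_bound hd hΩ_open hΩ_convex hΩ_bounded hR hK hδ hθ0 hθ hV hu hMA hTS hη0 hx
  have up := upper_bound hd hΩ_open hΩ_convex hΩ_bounded hR hK hh hδ hV hu hMA hTS hη0 hx
  set L := seminormC11 Ω u
  set H := δ ^ (α : ℝ) * seminormC2Holder Ω α u with hHdef
  have hH0 : 0 ≤ H := by positivity
  set P := h ^ 2 * (δ ^ 2)⁻¹ * L with hP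
  have hP0 : 0 ≤ P := by positivity
  have hQ0 : 0 ≤ h ^ 2 * L := by positivity
  have hT0 : 0 ≤ θ ^ 2 * L := by positivity
  have hR0 : 0 ≤ R ^ 2 := sq_nonneg R
  have hdR : R ^ 2 ≤ d * R ^ 2 := le_mul_of_one_le_left hR0 hd1
  have expand : (7 * d * R ^ 2 + 2) * ((h ^ 2 * (1 + (δ ^ 2)⁻¹) + θ ^ 2) * L + H) =
      7 * (d * R ^ 2 * (h ^ 2 * L)) + 7 * (d * R ^ 2 * P) + 7 * (d * R ^ 2 * (θ ^ 2 * L)) +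
        7 * (d * R ^ 2 * H) + 2 * (h ^ 2 * L) + 2 * P + 2 * (θ ^ 2 * L) + 2 * H := by
    rw [hP]; ring
  have lo' : u x - uh x ≤ R ^ 2 * H / 2 + 13 / 2 * (d * R ^ 2 * (θ ^ 2 * L)) + η * R ^ 2 := by
    linarith
  have up' : uh x - u x ≤ R ^ 2 * H / 2 + R ^ 2 * (θ ^ 2 * L) + R ^ 2 * P / 2 + η * R ^ 2 / 2 +
      3 / 2 * (h ^ 2 * L) := by
    rw [hP]; linarith
  have m1 := mul_le_mul_of_nonneg_right hdR hH0
  have m2 := mul_le_mul_of_nonneg_right hdR hT0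
  have m3 := mul_le_mul_of_nonneg_right hdR hP0
  have n1 := mul_nonneg hR0 hH0
  have n2 := mul_nonneg hR0 hT0
  have n3 := mul_nonneg hR0 hP0
  have n4 : 0 ≤ d * R ^ 2 * (h ^ 2 * L) := by positivity
  rw [expand, abs_le]
  constructor <;> linarith
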